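/- Let $V$ be a finite set (a supernode) with $p=|V|\ge 2$ elements, let $x\in\mathbb{R}^{n\times V}$ be a data matrix, $\delta>0$, and let $D\in\mathbb{R}^{V\times V}$ be symmetric positive definite. Consider the tree activation model: $T=(V,E)$ is uniformly distributed over all trees with vertex set $V$; given $T$, the precision matrix $\Delta$ has the Hyper-Wishart distribution with respect to $T$, that is, on the cone of symmetric positive definite matrices whose off-diagonal entries vanish off the edges of $T$ it has a density proportional to $|\Delta|^{(\delta-2)/2}\exp\{-\tfrac12\mathrm{tr}(\Delta D)\}$ with respect to Lebesgue measure on the free entries (the diagonal entries and one entry per edge); given $\Delta$, the $n$ rows of $x$ are independent $\mathcal{N}(0,\Delta^{-1})$. For $i\neq j$ in $V$ define $$g_{ij}(\delta,D)=\frac{\Gamma\{(\delta+1)/2\}\,(D_{ii}D_{jj})^{\delta/2}}{\Gamma(\delta/2)\,|D_{\{i,j\}}|^{(\delta+1)/2}},\qquad w_{ij}=\frac{g_{ij}(\delta+n,\;D+x^\top x)}{g_{ij}(\delta,D)},$$ where $D_{\{i,j\}}$ is the $2\times2$ submatrix of $D$ with rows and columns $i,j$. Let $\Lambda$ be the Laplacian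 of the weighted graph on $V$ with weights $w$, that is, $\Lambda_{ij}=-w_{ij}$ for $i\ne j$ and $\Lambda_{ii}=\sum_{j\neq i}w_{ij}$, let $\Lambda^{\nu}$ be $\Lambda$ with the rows and columns indexed by $\nu\subset V$ removed (the determinant of an empty matrix being $1$), and let $r(i,j)=|\Lambda^{\{i,j\}}|/|\Lambda^{\{i\}}|$ be the resistance distance. Then, for all $i\ne j$ in $V$: (i) Every tree has positive marginal likelihood, so that the posterior distribution of $T$ given $x$ is well defined, and $\Pr[(i,j)\in E\mid x]=w_{ij}\,r(i,j)$. (ii) $\Pr[(i,j)\in E\mid x]$ is an increasing function of $w_{ij}$: for arbitrary positive symmetric weights, the expression $w_{ij}\,r(i,j)$ is nondecreasing in $w_{ij}\in(0,\infty)$ when all other weights are held fixed, and strictly increasing if $p\ge 3$ (for $p=2$ it is constantly $1$). In particular, if two choices of $(n,\delta,D,x)$ on the same $V$ yield the same weights except possibly for the pair $\{i,j\}$, then the one with the larger (or equal) $w_{ij}$ has the larger (or equal) probability $\Pr[(i,j)\in E\mid x]$, strictly larger if its $w_{ij}$ is strictly larger and $p\ge3$. -/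

import Mathlib

namespace TreeActivation

noncomputable section

open Classical in
/-- The set of all trees with vertex set `V`. -/
def trees (V : Type*) [Fintype V] : Finset (SimpleGraph V) :=
  Finset.univ.filter (fun T => T.IsTree)

/-- The uniform distribution over all trees with vertex set `V`. -/
def treePrior (V : Type*) [Fintype V] (_T : SimpleGraph V) : ℝ :=
  ((trees V).card : ℝ)⁻¹

/-- The free entries of a symmetric matrix whose off-diagonal entries vanish off the edges of `T`:
one real per vertex (the diagonal) and one real per edge. -/
abbrev FreeEntries {V : Type*} (T : SimpleGraph V) : Type _ :=
  (V → ℝ) × (T.edgeSet → ℝ)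

open Classical in
/-- The symmetric matrix with the given free entries. -/
def precision {V : Type*} (T : SimpleGraph V) (θ : FreeEntries T) : Matrix V V ℝ :=
  Matrix.of fun a b =>
    if a = b then θ.1 a
    else if h : T.Adj a b then θ.2 ⟨s(a, b), (SimpleGraph.mem_edgeSet T).2 h⟩
    else 0

/-- The cone of positive definite matrices that vanish off the edges of `T`,
in the coordinates given by the free entries. -/
def cone {V : Type*} [Fintype V] (T : SimpleGraph V) : Set (FreeEntries T) :=
  {θ | (precision T θ).PosDef}

section

variable {V : Type*} [Fintype V] [DecidableEq V]

/-- The density of the Gaussian distribution with mean zero and covariance matrix `C`. -/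
def gaussianDensity (C : Matrix V V ℝ) (y : V → ℝ) : ℝ :=
  (2 * Real.pi) ^ (-(Fintype.card V : ℝ) / 2) * C.det ^ (-(1 / 2) : ℝ) *
    Real.exp (-(y ⬝ᵥ (C⁻¹).mulVec y) / 2)

/-- The likelihood of the data `x` (rows are independent observations, columns are variables)
under the precision matrix `Δ`. -/
def likelihood {n : ℕ} (x : Matrix (Fin n) V ℝ) (Δ : Matrix V V ℝ) : ℝ :=
  ∏ l : Fin n, gaussianDensity Δ⁻¹ (x l)

/-- The unnormalized Wishart density with degrees of freedom `δ` and rate matrix `D`. -/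
def wishartKernel (δ : ℝ) (D Δ : Matrix V V ℝ) : ℝ :=
  Δ.det ^ ((δ - 2) / 2) * Real.exp (-(Δ * D).trace / 2)

open Classical in
/-- The normalizing constant of the Hyper-Wishart distribution with respect to `T`;
the reference measure is Lebesgue measure on the free entries. -/
def hyperWishartConst (δ : ℝ) (D : Matrix V V ℝ) (T : SimpleGraph V) : ℝ :=
  ∫ θ in cone T, wishartKernel δ D (precision T θ)

/-- The density on `cone T` of the Hyper-Wishart distribution with respect to `T`. -/
def hyperWishartDensity (δ : ℝ) (D : Matrix V V ℝ) (T : SimpleGraph V) (θ : FreeEntries T) : ℝ :=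
  wishartKernel δ D (precision T θ) / hyperWishartConst δ D T

open Classical in
/-- The density of the data `x` given the tree `T`, with the precision matrix integrated out. -/
def treeLikelihood (δ : ℝ) (D : Matrix V V ℝ) {n : ℕ} (x : Matrix (Fin n) V ℝ)
    (T : SimpleGraph V) : ℝ :=
  ∫ θ in cone T, likelihood x (precision T θ) * hyperWishartDensity δ D T θ

/-- The tree activation function: the marginal density of the data `x`. -/
def treeActivation (δ : ℝ) (D : Matrix V V ℝ) {n : ℕ} (x : Matrix (Fin n) V ℝ) : ℝ :=
  ∑ T ∈ trees V, treePrior V T * treeLikelihood δ D x T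

/-- The posterior probability of the tree `T` given the data `x`. -/
def treePosterior (δ : ℝ) (D : Matrix V V ℝ) {n : ℕ} (x : Matrix (Fin n) V ℝ)
    (T : SimpleGraph V) : ℝ :=
  treePrior V T * treeLikelihood δ D x T / treeActivation δ D x

open Classical in
/-- The posterior probability that `{i, j}` is an edge of the tree, given the data `x`. -/
def edgeProb (δ : ℝ) (D : Matrix V V ℝ) {n : ℕ} (x : Matrix (Fin n) V ℝ) (i j : V) : ℝ :=
  ∑ T ∈ (trees V).filter (fun T => T.Adj i j), treePosterior δ D x T

/-- The edge term `g_ij(δ, D)`. -/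
def edgeTerm (δ : ℝ) (D : Matrix V V ℝ) (i j : V) : ℝ :=
  Real.Gamma ((δ + 1) / 2) * (D i i * D j j) ^ (δ / 2) /
    (Real.Gamma (δ / 2) * (D.submatrix ![i, j] ![i, j]).det ^ ((δ + 1) / 2))

/-- The weight `w_ij = g_ij(δ + n, D + xᵀ x) / g_ij(δ, D)`; only its values at `i ≠ j` are used. -/
def weight (δ : ℝ) (D : Matrix V V ℝ) {n : ℕ} (x : Matrix (Fin n) V ℝ) (i j : V) : ℝ :=
  edgeTerm (δ + n) (D + x.transpose * x) i j / edgeTerm δ D i j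

/-- The Laplacian matrix of the weighted graph with weights `w` (the diagonal of `w` is unused). -/
def laplacian (w : V → V → ℝ) : Matrix V V ℝ :=
  Matrix.of fun a b => if a = b then ∑ c ∈ Finset.univ.erase a, w a c else -w a b

/-- The matrix obtained from `L` by removing the rows and columns indexed by `ν`. -/
def removeRowsCols (L : Matrix V V ℝ) (ν : Finset V) : Matrix {a // a ∉ ν} {a // a ∉ ν} ℝ :=
  L.submatrix Subtype.val Subtype.val

/-- The resistance distance between `i` and `j` in the weighted graph with weights `w`. -/
def resistance (w : V → V → ℝ) (i j : V) : ℝ :=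
  (removeRowsCols (laplacian w) {i, j}).det / (removeRowsCols (laplacian w) {i}).det

/-- The weights `w` with the weight of the pair `{i, j}` replaced by `t`. -/
def setWeight (w : V → V → ℝ) (i j : V) (t : ℝ) : V → V → ℝ :=
  fun a b => if s(a, b) = s(i, j) then t else w a b

end

end

end TreeActivation

namespace TreeActivation

noncomputable section

/-! The normalizing constant of the Hyper-Wishart law on a tree factors as a constant independent of
the tree times the product of $g_{ij}$ over the edges (`lintegral_cone_wishartKernel`). This goes by
induction on the number of vertices. Remove a leaf $v$ with neighbour $u$, let $a$ be its diagonal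
entry and $b$ its edge entry. The Schur complement of $a$ is the remaining matrix with $b^2/a$
subtracted at $(u,u)$. That entry is free, so the correction is a translation, Lebesgue measure is
preserved, and the integral splits into a two-dimensional leaf integral and the integral for the
smaller tree. Completing the square in $b$ and then a Gamma integral in $a$ give $g_{vu}$ times a
factor attached to $v$.

By conjugacy (`likelihood_mul_wishartKernel`), data replace $(\delta, D)$ by $(\delta+n, D+x^\top
x)$, so the marginal likelihood of $T$ is a positive constant times the product of its weights
$w_{ij}$. The edge probability is therefore the share of the total tree weight carried by trees
through $\{i,j\}$.

The total is $|\Lambda^{\{i\}}|$ by the weighted matrix-tree theorem, proved by expanding the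
determinant over all choices of a parent for each vertex other than $i$. It is affine in $w_{ij}$
with slope $|\Lambda^{\{i,j\}}|$, so that minor sums the tree weights with the factor $w_{ij}$ left
out, which gives (i). For (ii), the probability has the form $tB/(tB+A)$ with $t=w_{ij}$ and $A$,
$B$ free of $t$; here $B>0$, $A\ge0$, and $A>0$ once a third vertex exists. -/

open Classical in
/-- The product of the weights `W` over the edges of `T`. -/
def edgeProd {V : Type*} [Fintype V] (W : Sym2 V → ℝ) (T : SimpleGraph V) : ℝ :=
  ∏ e ∈ T.edgeFinset, W e

/-! ### The weighted matrix-tree theorem, via parent functions -/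

section MatrixTree

variable {V : Type*} {i : V}

/-- A parent function, defined off the root `i`, is acyclic if it decreases some depth. -/
def AcyclicParent (f : {a // a ∉ ({i} : Finset V)} → V) : Prop :=
  ∃ d : V → ℕ, ∀ a, d (f a) < d a

/-- The graph that joins every vertex to its parent. -/
def parentGraph (f : {a // a ∉ ({i} : Finset V)} → V) : SimpleGraph V :=
  SimpleGraph.fromRel fun a b => ∃ h : a ∉ ({i} : Finset V), f ⟨a, h⟩ = b

/-- The matrix `1 - P`, where `P` is the transition matrix of `f` killed at the root. -/
def parentMatrix [DecidableEq V] (f : {a // a ∉ ({i} : Finset V)} → V) :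
    Matrix {a // a ∉ ({i} : Finset V)} {a // a ∉ ({i} : Finset V)} ℝ :=
  Matrix.of fun a b => (if a = b then 1 else 0) - (if f a = b then 1 else 0)

lemma AcyclicParent.ne {f : {a // a ∉ ({i} : Finset V)} → V} (hf : AcyclicParent f)
    (a : {a // a ∉ ({i} : Finset V)}) : (a : V) ≠ f a := by
  obtain ⟨d, hd⟩ := hf
  intro h
  have := hd a
  rw [← h] at this
  exact lt_irrefl _ this

/-- Two distinct vertices giving the same edge would be parents of each other, hence each strictly
shallower than the other. -/
lemma AcyclicParent.injective {f : {a // a ∉ ({i} : Finset V)} → V} (hf : AcyclicParent f) :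
    Function.Injective fun a : {a // a ∉ ({i} : Finset V)} => s((a : V), f a) := by
  obtain ⟨d, hd⟩ := hf
  intro a b h
  rcases Sym2.eq_iff.1 h with ⟨h, -⟩ | ⟨h1, h2⟩
  · exact Subtype.ext h
  · have ha := hd a
    have hb := hd b
    rw [h2] at ha
    rw [← h1] at hb
    omega

lemma AcyclicParent.adj_iff {f : {a // a ∉ ({i} : Finset V)} → V} (hf : AcyclicParent f)
    (x y : V) : (parentGraph f).Adj x y ↔
      ∃ a : {a // a ∉ ({i} : Finset V)}, s((a : V), f a) = s(x, y) := by
  rw [parentGraph, SimpleGraph.fromRel_adj]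
  constructor
  · rintro ⟨-, ⟨h, e⟩ | ⟨h, e⟩⟩
    · exact ⟨⟨x, h⟩, by rw [e]⟩
    · exact ⟨⟨y, h⟩, by rw [e, Sym2.eq_swap]⟩
  · rintro ⟨a, h⟩
    have hne := hf.ne a
    rcases Sym2.eq_iff.1 h with ⟨h1, h2⟩ | ⟨h1, h2⟩
    · subst h1 h2
      exact ⟨hne, Or.inl ⟨a.2, rfl⟩⟩
    · subst h1 h2
      exact ⟨hne.symm, Or.inr ⟨a.2, rfl⟩⟩

open Classical in
lemma AcyclicParent.edgeFinset [Fintype V] [DecidableEq V] {f : {a // a ∉ ({i} : Finset V)} → V}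
    (hf : AcyclicParent f) :
    (parentGraph f).edgeFinset =
      Finset.univ.image fun a : {a // a ∉ ({i} : Finset V)} => s((a : V), f a) := by
  ext e
  induction e with
  | h x y => simp only [SimpleGraph.mem_edgeFinset, SimpleGraph.mem_edgeSet, hf.adj_iff,
      Finset.mem_image, Finset.mem_univ, true_and]

lemma AcyclicParent.edgeProd {f : {a // a ∉ ({i} : Finset V)} → V} (hf : AcyclicParent f)
    [Fintype V] [DecidableEq V] (W : Sym2 V → ℝ) :
    edgeProd W (parentGraph f) = ∏ a : {a // a ∉ ({i} : Finset V)}, W s((a : V), f a) := by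
  classical
  rw [TreeActivation.edgeProd]
  convert Finset.prod_image (s := Finset.univ) (f := W) hf.injective.injOn using 2
  convert hf.edgeFinset

lemma AcyclicParent.connected {f : {a // a ∉ ({i} : Finset V)} → V} (hf : AcyclicParent f) :
    (parentGraph f).Connected := by
  obtain ⟨d, hd⟩ := id hf
  have key : ∀ n a, d a = n → (parentGraph f).Reachable a i := by
    intro n
    induction n using Nat.strong_induction_on with
    | _ n ih =>
      intro a ha
      by_cases h : a = i
      · rw [h]
      · have h' : a ∉ ({i} : Finset V) := by simpa using h
        have hadj : (parentGraph f).Adj a (f ⟨a, h'⟩) := (hf.adj_iff _ _).2 ⟨⟨a, h'⟩, rfl⟩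
        exact hadj.reachable.trans (ih _ (ha ▸ hd ⟨a, h'⟩) _ rfl)
  exact (SimpleGraph.connected_iff _).2
    ⟨fun a b => (key _ a rfl).trans (key _ b rfl).symm, ⟨i⟩⟩

lemma AcyclicParent.isTree [Fintype V] [DecidableEq V] {f : {a // a ∉ ({i} : Finset V)} → V}
    (hf : AcyclicParent f) :
    (parentGraph f).IsTree := by
  classical
  rw [SimpleGraph.isTree_iff_connected_and_card]
  refine ⟨hf.connected, ?_⟩
  rw [Nat.card_eq_fintype_card, ← SimpleGraph.edgeFinset_card, hf.edgeFinset,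
    Finset.card_image_of_injective _ hf.injective, Finset.card_univ, Nat.card_eq_fintype_card,
    Fintype.card_subtype_compl]
  have : 0 < Fintype.card V := Fintype.card_pos_iff.2 ⟨i⟩
  simp only [Finset.mem_singleton, Fintype.card_unique]
  omega

/-- Induction on depth along `f`. If the edge from `a` to `f a` does not come from `g a = f a`, then
`g (f a) = a`; the induction hypothesis at `f a` gives `f (f a) = a`, a cycle. -/
lemma AcyclicParent.eq_of_parentGraph_eq {f g : {a // a ∉ ({i} : Finset V)} → V}
    (hf : AcyclicParent f) (hg : AcyclicParent g) (h : parentGraph f = parentGraph g) :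
    f = g := by
  obtain ⟨d, hd⟩ := id hf
  have key : ∀ n (a : {a // a ∉ ({i} : Finset V)}), d a = n → f a = g a := by
    intro n
    induction n using Nat.strong_induction_on with
    | _ n ih =>
      intro a ha
      have hadj : (parentGraph g).Adj a (f a) := h ▸ (hf.adj_iff _ _).2 ⟨a, rfl⟩
      obtain ⟨b, hb⟩ := (hg.adj_iff _ _).1 hadj
      rcases Sym2.eq_iff.1 hb with ⟨h1, h2⟩ | ⟨h1, h2⟩
      · rw [← h2, Subtype.ext h1]
      · have hlt := hd a
        rw [← h1] at hlt
        have := ih _ (ha ▸ hlt) b rfl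
        rw [h2] at this
        have hb' := hd b
        rw [this] at hb'
        omega
  exact funext fun a => key _ a rfl

/-- The parent is a neighbour nearer to the root. The resulting graph is a connected subgraph of
`T`, and a tree is minimal among connected graphs. -/
lemma exists_acyclicParent [Fintype V] [DecidableEq V] {T : SimpleGraph V} (hT : T.IsTree) (i : V) :
    ∃ f : {a // a ∉ ({i} : Finset V)} → V, AcyclicParent f ∧ parentGraph f = T := by
  have h : ∀ a : {a // a ∉ ({i} : Finset V)}, ∃ b, T.Adj a b ∧ T.dist b i < T.dist a i := by
    rintro ⟨a, ha⟩
    obtain ⟨p, hp⟩ := hT.connected.exists_walk_length_eq_dist a i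
    cases p with
    | nil => simp at ha
    | cons hadj q =>
      refine ⟨_, hadj, ?_⟩
      rw [← hp, SimpleGraph.Walk.length_cons]
      exact Nat.lt_succ_of_le (SimpleGraph.dist_le q)
  choose f hf1 hf2 using h
  have hf : AcyclicParent f := ⟨fun a => T.dist a i, hf2⟩
  refine ⟨f, hf, le_antisymm ?_ ?_⟩
  · intro x y hxy
    obtain ⟨a, ha⟩ := (hf.adj_iff _ _).1 hxy
    have := hf1 a
    rwa [← SimpleGraph.mem_edgeSet, ha, SimpleGraph.mem_edgeSet] at this
  · refine (SimpleGraph.isTree_iff_minimal_connected.1 hT).2 hf.connected ?_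
    intro x y hxy
    obtain ⟨a, ha⟩ := (hf.adj_iff _ _).1 hxy
    have := hf1 a
    rwa [← SimpleGraph.mem_edgeSet, ha, SimpleGraph.mem_edgeSet] at this

/-- Parents are shallower than their children, so in order of decreasing depth the matrix is block
triangular with identity blocks. -/
lemma det_parentMatrix_of_acyclic [Fintype V] [DecidableEq V] {f : {a // a ∉ ({i} : Finset V)} → V}
    (hf : AcyclicParent f) : (parentMatrix f).det = 1 := by
  obtain ⟨d, hd⟩ := id hf
  have hbt : (parentMatrix f).BlockTriangular
      (fun a : {a // a ∉ ({i} : Finset V)} => OrderDual.toDual (d a)) := by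
    intro a b hab
    have hab : d (a : V) < d b := hab
    have h1 : a ≠ b := by rintro rfl; exact lt_irrefl _ hab
    have h2 : f a ≠ b := by
      intro h
      have := hd a
      rw [h] at this
      omega
    simp [parentMatrix, h1, h2]
  rw [hbt.det]
  refine Finset.prod_eq_one fun k _ => ?_
  suffices h : (parentMatrix f).toSquareBlock _ k = 1 by rw [h, Matrix.det_one]
  ext ⟨a, ha⟩ ⟨b, hb⟩
  have h2 : f a ≠ b := by
    intro h
    have := hd a
    rw [h] at this
    have e : d (a : V) = d b := OrderDual.toDual.injective (ha.trans hb.symm)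
    omega
  simp [Matrix.toSquareBlock, Matrix.toSquareBlockProp, parentMatrix, h2, Matrix.one_apply]

/-- The vertices from which the root can be reached along `f`. -/
inductive ReachesRoot (f : {a // a ∉ ({i} : Finset V)} → V) : ℕ → V → Prop
  | root : ReachesRoot f 0 i
  | step (n : ℕ) (a) : ReachesRoot f n (f a) → ReachesRoot f (n + 1) a

lemma reachesRoot_succ_iff {f : {a // a ∉ ({i} : Finset V)} → V} {n : ℕ}
    {a : {a // a ∉ ({i} : Finset V)}} : ReachesRoot f (n + 1) a ↔ ReachesRoot f n (f a) := by
  refine ⟨fun h => ?_, fun h => .step n a h⟩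
  obtain ⟨a, ha⟩ := a
  cases h with
  | step _ _ h => exact h

lemma reachesRoot_zero_iff {f : {a // a ∉ ({i} : Finset V)} → V} {a : V} :
    ReachesRoot f 0 a ↔ a = i := by
  refine ⟨fun h => ?_, fun h => h.symm ▸ .root⟩
  cases h
  rfl

lemma acyclicParent_of_reachesRoot {f : {a // a ∉ ({i} : Finset V)} → V}
    (h : ∀ a, ∃ n, ReachesRoot f n a) : AcyclicParent f := by
  classical
  refine ⟨fun a => Nat.find (h a), fun a => ?_⟩
  have hspec := Nat.find_spec (h (a : V))
  obtain ⟨m, hm⟩ : ∃ m, Nat.find (h (a : V)) = m + 1 := by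
    refine Nat.exists_eq_succ_of_ne_zero fun h0 => ?_
    rw [h0] at hspec
    exact a.2 (Finset.mem_singleton.2 (reachesRoot_zero_iff.1 hspec))
  rw [hm] at hspec
  change Nat.find (h (f a)) < Nat.find (h (a : V))
  rw [hm]
  exact Nat.lt_succ_of_le (Nat.find_min' _ (reachesRoot_succ_iff.1 hspec))

/-- The indicator of the vertices that never reach the root is constant along `f` and zero at the
root, so it is a nonzero kernel vector. -/
lemma det_parentMatrix_of_not_acyclic [Fintype V] [DecidableEq V] {f : {a // a ∉ ({i} : Finset V)} → V}
    (hf : ¬ AcyclicParent f) : (parentMatrix f).det = 0 := by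
  classical
  obtain ⟨c, hc⟩ : ∃ c, ¬ ∃ n, ReachesRoot f n c := by
    by_contra! h
    exact hf (acyclicParent_of_reachesRoot h)
  have hci : c ∉ ({i} : Finset V) := by
    rw [Finset.mem_singleton]
    rintro rfl
    exact hc ⟨0, .root⟩
  let v : V → ℝ := fun a => if ∃ n, ReachesRoot f n a then 0 else 1
  have hvi : v i = 0 := if_pos ⟨0, .root⟩
  have hv : ∀ a : {a // a ∉ ({i} : Finset V)}, v (f a) = v a := by
    intro a
    have : (∃ n, ReachesRoot f n (f a)) ↔ ∃ n, ReachesRoot f n (a : V) := by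
      refine ⟨fun ⟨n, h⟩ => ⟨n + 1, .step n a h⟩, fun ⟨n, h⟩ => ?_⟩
      cases n with
      | zero =>
        exact absurd (Finset.mem_singleton.2 (reachesRoot_zero_iff.1 h)) a.2
      | succ n => exact ⟨n, reachesRoot_succ_iff.1 h⟩
    simp only [v, this]
  refine Matrix.exists_mulVec_eq_zero_iff.1 ⟨fun a => v a, fun h => ?_, ?_⟩
  · have := congrFun h ⟨c, hci⟩
    simp [v, if_neg hc] at this
  · ext a
    have h2 : ∑ b : {a // a ∉ ({i} : Finset V)}, (if f a = b then v b else 0) = v (f a) := by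
      by_cases hfa : f a ∈ ({i} : Finset V)
      · rw [Finset.mem_singleton.1 hfa, hvi]
        refine Finset.sum_eq_zero fun b _ => if_neg ?_
        rintro h
        exact b.2 (Finset.mem_singleton.2 h.symm)
      · rw [Finset.sum_eq_single ⟨f a, hfa⟩]
        · simp
        · intro b _ hb
          refine if_neg fun h => hb (Subtype.ext h.symm)
        · simp
    have h1 : (parentMatrix f).mulVec (fun a => v a) a = v a - v (f a) := by
      simp only [parentMatrix, Matrix.mulVec, dotProduct, Matrix.of_apply, sub_mul, ite_mul,
        one_mul, zero_mul, Finset.sum_sub_distrib, h2]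
      simp
    rw [h1, hv, sub_self]
    rfl

/-- The weights on pairs of vertices given by a function on unordered pairs. -/
abbrev pairWeight (W : Sym2 V → ℝ) (a b : V) : ℝ := W s(a, b)

/-- Row `a` of the reduced Laplacian is the sum over `c` of `w a c` times $e_a - e_c$, with $e_i$
read as zero. Multilinearity in the rows chooses one `c` per row, that is, a parent function. -/
lemma det_laplacian_eq_sum_parent [Fintype V] [DecidableEq V] (w : V → V → ℝ) (i : V) :
    (removeRowsCols (laplacian w) {i}).det =
      ∑ f : {a // a ∉ ({i} : Finset V)} → V, (∏ a : {a // a ∉ ({i} : Finset V)}, w a (f a)) *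
        (parentMatrix f).det := by
  have hrow : removeRowsCols (laplacian w) {i} = fun a : {a // a ∉ ({i} : Finset V)} =>
      ∑ c : V, w a c • fun b : {a // a ∉ ({i} : Finset V)} =>
        ((if a = b then 1 else 0) - (if c = b then 1 else 0) : ℝ) := by
    ext a b
    simp only [removeRowsCols, laplacian, Matrix.submatrix_apply, Matrix.of_apply,
      Finset.sum_apply, Pi.smul_apply, smul_eq_mul, Subtype.coe_inj]
    by_cases h : a = b
    · subst h
      -- The term `c = a` vanishes, so the unused diagonal of `w` does not enter.
      rw [← Finset.add_sum_erase _ _ (Finset.mem_univ (a : V))]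
      simp only [if_true, sub_self, mul_zero, zero_add]
      refine Finset.sum_congr rfl fun c hc => ?_
      rw [if_neg (Finset.ne_of_mem_erase hc)]
      ring
    · simp [h]
  have := (Matrix.detRowAlternating (R := ℝ)
    (n := {a // a ∉ ({i} : Finset V)})).toMultilinearMap.map_sum
      (fun (a : {a // a ∉ ({i} : Finset V)}) (c : V) => w a c •
        fun b : {a // a ∉ ({i} : Finset V)} =>
          ((if a = b then 1 else 0) - (if c = b then 1 else 0) : ℝ))
  rw [hrow]
  refine Eq.trans this (Finset.sum_congr rfl fun f _ => ?_)
  exact MultilinearMap.map_smul_univ _ (fun a : {a // a ∉ ({i} : Finset V)} => w a (f a)) _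

lemma mem_trees [Fintype V] {T : SimpleGraph V} : T ∈ trees V ↔ T.IsTree := by
  simp [trees]

/-- **Weighted matrix-tree theorem.** -/
theorem det_laplacian_eq_sum_trees [Fintype V] [DecidableEq V] (W : Sym2 V → ℝ) (i : V) :
    (removeRowsCols (laplacian (pairWeight W)) {i}).det = ∑ T ∈ trees V, edgeProd W T := by
  classical
  have h : ∑ f : {a // a ∉ ({i} : Finset V)} → V,
      (∏ a : {a // a ∉ ({i} : Finset V)}, pairWeight W a (f a)) * (parentMatrix f).det =
      ∑ f : {a // a ∉ ({i} : Finset V)} → V with AcyclicParent f,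
        ∏ a : {a // a ∉ ({i} : Finset V)}, W s((a : V), f a) := by
    rw [Finset.sum_filter]
    refine Finset.sum_congr rfl fun f _ => ?_
    split_ifs with hf
    · rw [det_parentMatrix_of_acyclic hf, mul_one]
    · rw [det_parentMatrix_of_not_acyclic hf, mul_zero]
  refine (det_laplacian_eq_sum_parent _ i).trans (h.trans ?_)
  refine Finset.sum_bij (fun f _ => parentGraph f) ?_ ?_ ?_ ?_
  · intro f hf
    exact mem_trees.2 (Finset.mem_filter.1 hf).2.isTree
  · intro f hf g hg h
    exact (Finset.mem_filter.1 hf).2.eq_of_parentGraph_eq (Finset.mem_filter.1 hg).2 h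
  · intro T hT
    obtain ⟨f, hf, rfl⟩ := exists_acyclicParent (mem_trees.1 hT) i
    exact ⟨f, Finset.mem_filter.2 ⟨Finset.mem_univ _, hf⟩, rfl⟩
  · intro f hf
    rw [(Finset.mem_filter.1 hf).2.edgeProd]

end MatrixTree

/-! ### Edge marginals of weighted random trees, and monotonicity -/

section EdgeMarginal

variable {V : Type*} [Fintype V] {i j : V}

/-- The determinant is linear in row `j`, which changes by $t e_j$. With row `j` replaced by $e_j$
the matrix is block triangular, and the complementary block also lacks `j`. -/
lemma det_removeRowsCols_add_single [DecidableEq V] (hij : i ≠ j) {L L' : Matrix V V ℝ} {t : ℝ}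
    (h : ∀ a b, a ≠ i → b ≠ i → L' a b = L a b + if a = j ∧ b = j then t else 0) :
    (removeRowsCols L' {i}).det =
      (removeRowsCols L {i}).det + t * (removeRowsCols L {i, j}).det := by
  have hj : j ∉ ({i} : Finset V) := by simpa using hij.symm
  set M := removeRowsCols L {i} with hM
  have hM' : removeRowsCols L' {i} =
      M.updateRow ⟨j, hj⟩ (M ⟨j, hj⟩ + t • Pi.single ⟨j, hj⟩ 1) := by
    ext ⟨a, ha⟩ ⟨b, hb⟩
    have := h a b (by simpa using ha) (by simpa using hb)
    simp only [removeRowsCols, Matrix.submatrix_apply, this, Matrix.updateRow_apply,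
      Subtype.mk.injEq, Pi.add_apply, Pi.smul_apply, Pi.single_apply, hM]
    by_cases h1 : a = j <;> by_cases h2 : b = j <;> simp [h1, h2]
  rw [hM', Matrix.det_updateRow_add, Matrix.updateRow_eq_self, Matrix.det_updateRow_smul]
  congr 2
  rw [Matrix.twoBlockTriangular_det' _ (fun a : {a // a ∉ ({i} : Finset V)} => (a : V) = j)]
  · have h1 : ((M.updateRow ⟨j, hj⟩ (Pi.single ⟨j, hj⟩ 1)).toSquareBlockProp
        fun a => (a : V) = j) = 1 := by
      ext ⟨⟨a, ha'⟩, ha⟩ ⟨⟨b, hb'⟩, hb⟩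
      have ha : a = j := ha
      have hb : b = j := hb
      subst ha hb
      simp [Matrix.toSquareBlockProp]
    rw [h1, Matrix.det_one, one_mul]
    let e : {a : {a // a ∉ ({i} : Finset V)} // ¬ (a : V) = j} ≃
        {a // a ∉ ({i, j} : Finset V)} :=
      { toFun := fun a => ⟨a.1.1, by
          have h1 := a.1.2
          have h2 := a.2
          simp_all⟩
        invFun := fun a => ⟨⟨a.1, by have := a.2; simp_all⟩, by have := a.2; simp_all⟩
        left_inv := fun a => rfl
        right_inv := fun a => rfl }
    rw [← Matrix.det_submatrix_equiv_self e]
    congr 1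
    ext ⟨a, ha⟩ ⟨b, hb⟩
    change M.updateRow ⟨j, hj⟩ (Pi.single ⟨j, hj⟩ 1) a b = _
    rw [Matrix.updateRow_ne fun h => ha (congrArg Subtype.val h)]
    rfl
  · rintro ⟨a, ha'⟩ ha b hb
    have ha : a = j := ha
    subst ha
    have : b ≠ ⟨a, hj⟩ := fun h => hb (congrArg Subtype.val h)
    simp [this]

/-- Once row and column `i` are gone, the weight of $\{i,j\}$ survives only in the diagonal entry at
`j`. -/
lemma det_laplacian_add_single [DecidableEq V] (hij : i ≠ j) (W : Sym2 V → ℝ) :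
    (removeRowsCols (laplacian (pairWeight (W + Pi.single s(i, j) 1))) {i}).det =
      (removeRowsCols (laplacian (pairWeight W)) {i}).det +
        (removeRowsCols (laplacian (pairWeight W)) {i, j}).det := by
  rw [det_removeRowsCols_add_single hij (L := laplacian (pairWeight W)) (t := 1), one_mul]
  intro a b ha hb
  simp only [laplacian, Matrix.of_apply, pairWeight, Pi.add_apply, Pi.single_apply]
  by_cases hab : a = b
  · subst hab
    simp only [if_true, and_self, Finset.sum_add_distrib]
    congr 1
    by_cases haj : a = j
    · subst haj
      rw [if_pos rfl, Finset.sum_eq_single i]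
      · rw [if_pos Sym2.eq_swap]
      · intro c _ hc
        refine if_neg fun h => ?_
        rcases Sym2.eq_iff.1 h with ⟨h, -⟩ | ⟨-, h⟩
        exacts [ha h, hc h]
      · intro h
        simp [hij] at h
    · rw [if_neg haj]
      refine Finset.sum_eq_zero fun c _ => if_neg fun h => ?_
      rcases Sym2.eq_iff.1 h with ⟨h, -⟩ | ⟨h, -⟩
      exacts [ha h, haj h]
  · have h1 : ¬ (a = j ∧ b = j) := fun h => hab (h.1.trans h.2.symm)
    have h2 : s(a, b) ≠ s(i, j) := fun h => by
      rcases Sym2.eq_iff.1 h with ⟨h, -⟩ | ⟨-, h⟩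
      exacts [ha h, hb h]
    simp [hab, h1, h2]

open Classical in
/-- The product of the weights over the edges of `T` other than `e`. -/
def edgeProdErase (W : Sym2 V → ℝ) (e : Sym2 V) (T : SimpleGraph V) : ℝ :=
  ∏ e' ∈ T.edgeFinset.erase e, W e'

lemma edgeProd_congr {W W' : Sym2 V → ℝ} {T : SimpleGraph V}
    (h : ∀ a b, T.Adj a b → W s(a, b) = W' s(a, b)) : edgeProd W T = edgeProd W' T := by
  refine Finset.prod_congr rfl fun e he => ?_
  induction e with
  | h a b => exact h a b (by simpa using he)

lemma edgeProdErase_congr {W W' : Sym2 V → ℝ} {e : Sym2 V} {T : SimpleGraph V}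
    (h : ∀ a b, T.Adj a b → s(a, b) ≠ e → W s(a, b) = W' s(a, b)) :
    edgeProdErase W e T = edgeProdErase W' e T := by
  classical
  refine Finset.prod_congr rfl fun e' he => ?_
  induction e' with
  | h a b =>
    have := Finset.mem_of_mem_erase he
    exact h a b (by simpa using this) (Finset.ne_of_mem_erase he)

lemma edgeProd_pos {W : Sym2 V → ℝ} (hW : ∀ a b, a ≠ b → 0 < W s(a, b)) (T : SimpleGraph V) :
    0 < edgeProd W T := by
  refine Finset.prod_pos fun e he => ?_
  induction e with
  | h a b => exact hW a b (SimpleGraph.Adj.ne (by simpa using he))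

lemma edgeProdErase_pos {W : Sym2 V → ℝ} (hW : ∀ a b, a ≠ b → 0 < W s(a, b)) (e : Sym2 V)
    (T : SimpleGraph V) : 0 < edgeProdErase W e T := by
  classical
  refine Finset.prod_pos fun e' he => ?_
  induction e' with
  | h a b =>
    have := Finset.mem_of_mem_erase he
    exact hW a b (SimpleGraph.Adj.ne (by simpa using this))

lemma edgeProd_eq_mul_edgeProdErase (W : Sym2 V → ℝ) {T : SimpleGraph V} (h : T.Adj i j) :
    edgeProd W T = W s(i, j) * edgeProdErase W s(i, j) T := by
  classical
  rw [edgeProd, edgeProdErase, Finset.mul_prod_erase]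
  simpa using h

-- Compare the tree sums for `W` and for `W` raised by one at $\{i,j\}$: a tree through that edge
-- gains its product over the other edges, and any other tree gains nothing.
open Classical in
lemma det_laplacian_pair_eq_sum_trees [DecidableEq V] (hij : i ≠ j) (W : Sym2 V → ℝ) :
    (removeRowsCols (laplacian (pairWeight W)) {i, j}).det =
      ∑ T ∈ (trees V).filter (fun T => T.Adj i j), edgeProdErase W s(i, j) T := by
  have h := det_laplacian_add_single hij W
  rw [det_laplacian_eq_sum_trees, det_laplacian_eq_sum_trees, ← sub_eq_iff_eq_add',
    ← Finset.sum_sub_distrib] at h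
  rw [← h, Finset.sum_filter]
  refine Finset.sum_congr rfl fun T _ => ?_
  split_ifs with hT
  · have : edgeProdErase (W + Pi.single s(i, j) 1) s(i, j) T = edgeProdErase W s(i, j) T := by
      refine edgeProdErase_congr fun a b _ hne => ?_
      simp [hne]
    rw [edgeProd_eq_mul_edgeProdErase _ hT, edgeProd_eq_mul_edgeProdErase _ hT, this]
    simp only [Pi.add_apply, Pi.single_eq_same]
    ring
  · have : edgeProd (W + Pi.single s(i, j) 1) T = edgeProd W T := by
      refine edgeProd_congr fun a b hab => ?_
      have : s(a, b) ≠ s(i, j) := fun h => hT (by rwa [← SimpleGraph.mem_edgeSet, ← h])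
      simp [this]
    rw [this, sub_self]

open Classical in
/-- The probability of an edge under the distribution on trees that is proportional to the product
of the edge weights is the weight times the resistance distance. -/
lemma mul_resistance_eq_div [DecidableEq V] (hij : i ≠ j) (W : Sym2 V → ℝ) :
    W s(i, j) * resistance (pairWeight W) i j =
      (∑ T ∈ (trees V).filter (fun T => T.Adj i j), edgeProd W T) /
        ∑ T ∈ trees V, edgeProd W T := by
  rw [resistance, det_laplacian_pair_eq_sum_trees hij, det_laplacian_eq_sum_trees,
    ← mul_div_assoc, Finset.mul_sum]
  congr 1
  refine Finset.sum_congr rfl fun T hT => ?_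
  rw [edgeProd_eq_mul_edgeProdErase _ (Finset.mem_filter.1 hT).2]

/-- Stars witness that the tree sums are nonempty: centred at `i` they contain $\{i,j\}$, centred at
a third vertex they avoid it. -/
lemma exists_star [DecidableEq V] (k : V) : ∃ T : SimpleGraph V, T.IsTree ∧
    ∀ a b, T.Adj a b ↔ a ≠ b ∧ (a = k ∨ b = k) := by
  have hf : AcyclicParent fun _ : {a // a ∉ ({k} : Finset V)} => k :=
    ⟨fun a => if a = k then 0 else 1, fun a => by simp [Finset.mem_singleton.not.1 a.2]⟩
  refine ⟨_, hf.isTree, fun a b => ?_⟩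
  rw [hf.adj_iff]
  constructor
  · rintro ⟨⟨c, hc⟩, h⟩
    have hc : c ≠ k := by simpa using hc
    rcases Sym2.eq_iff.1 h with ⟨rfl, rfl⟩ | ⟨rfl, rfl⟩
    exacts [⟨hc, Or.inr rfl⟩, ⟨hc.symm, Or.inl rfl⟩]
  · rintro ⟨hne, rfl | rfl⟩
    exacts [⟨⟨b, by simpa using hne.symm⟩, Sym2.eq_swap⟩, ⟨⟨a, by simpa using hne⟩, rfl⟩]

-- This isolates the dependence on the weight $t$ of $\{i,j\}$ as $tB/(tB+A)$.
open Classical in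
lemma mul_resistance_eq [DecidableEq V] (hij : i ≠ j) (W : Sym2 V → ℝ) :
    W s(i, j) * resistance (pairWeight W) i j =
      W s(i, j) * (∑ T ∈ (trees V).filter (fun T => T.Adj i j), edgeProdErase W s(i, j) T) /
        (W s(i, j) * (∑ T ∈ (trees V).filter (fun T => T.Adj i j), edgeProdErase W s(i, j) T) +
          ∑ T ∈ (trees V).filter (fun T => ¬ T.Adj i j), edgeProd W T) := by
  have h : W s(i, j) * (∑ T ∈ (trees V).filter (fun T => T.Adj i j), edgeProdErase W s(i, j) T) =
      ∑ T ∈ (trees V).filter (fun T => T.Adj i j), edgeProd W T := by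
    rw [Finset.mul_sum]
    refine Finset.sum_congr rfl fun T hT => ?_
    rw [edgeProd_eq_mul_edgeProdErase _ (Finset.mem_filter.1 hT).2]
  rw [h, mul_resistance_eq_div hij, Finset.sum_filter_add_sum_filter_not]

/-- If two systems of positive weights differ at `{i, j}` only, then the one with the larger weight
has the larger product of weight and resistance. -/
lemma mul_resistance_mono [DecidableEq V] (hij : i ≠ j) {W W' : Sym2 V → ℝ}
    (hW : ∀ a b, a ≠ b → 0 < W s(a, b)) (hW' : ∀ a b, a ≠ b → 0 < W' s(a, b))
    (h : ∀ a b, a ≠ b → s(a, b) ≠ s(i, j) → W s(a, b) = W' s(a, b)) :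
    (W s(i, j) ≤ W' s(i, j) →
      W s(i, j) * resistance (pairWeight W) i j ≤ W' s(i, j) * resistance (pairWeight W') i j) ∧
    (3 ≤ Fintype.card V → W s(i, j) < W' s(i, j) →
      W s(i, j) * resistance (pairWeight W) i j < W' s(i, j) * resistance (pairWeight W') i j) := by
  classical
  have hB : ∑ T ∈ (trees V).filter (fun T => T.Adj i j), edgeProdErase W' s(i, j) T =
      ∑ T ∈ (trees V).filter (fun T => T.Adj i j), edgeProdErase W s(i, j) T := by
    exact Finset.sum_congr rfl fun T _ =>
      edgeProdErase_congr fun a b hadj hne => (h a b hadj.ne hne).symm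
  have hA : ∑ T ∈ (trees V).filter (fun T => ¬ T.Adj i j), edgeProd W' T =
      ∑ T ∈ (trees V).filter (fun T => ¬ T.Adj i j), edgeProd W T := by
    refine Finset.sum_congr rfl fun T hT => edgeProd_congr fun a b hadj => ?_
    refine (h a b hadj.ne fun h => (Finset.mem_filter.1 hT).2 ?_).symm
    rwa [← SimpleGraph.mem_edgeSet, ← h]
  have hBpos : 0 < ∑ T ∈ (trees V).filter (fun T => T.Adj i j), edgeProdErase W s(i, j) T := by
    refine Finset.sum_pos (fun T _ => edgeProdErase_pos hW _ T) ?_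
    obtain ⟨T, hT, hadj⟩ := exists_star i
    exact ⟨T, Finset.mem_filter.2 ⟨mem_trees.2 hT, (hadj _ _).2 ⟨hij, Or.inl rfl⟩⟩⟩
  have hAnonneg : 0 ≤ ∑ T ∈ (trees V).filter (fun T => ¬ T.Adj i j), edgeProd W T :=
    Finset.sum_nonneg fun T _ => (edgeProd_pos hW T).le
  have hApos : 3 ≤ Fintype.card V →
      0 < ∑ T ∈ (trees V).filter (fun T => ¬ T.Adj i j), edgeProd W T := by
    intro hcard
    refine Finset.sum_pos (fun T _ => edgeProd_pos hW T) ?_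
    obtain ⟨k, hk⟩ : ∃ k, k ∉ ({i, j} : Finset V) := by
      by_contra! hk
      have := Finset.card_le_card (fun a _ => hk a : (Finset.univ : Finset V) ⊆ {i, j})
      rw [Finset.card_univ, Finset.card_pair hij] at this
      omega
    obtain ⟨T, hT, hadj⟩ := exists_star k
    refine ⟨T, Finset.mem_filter.2 ⟨mem_trees.2 hT, fun h => ?_⟩⟩
    rcases ((hadj _ _).1 h).2 with rfl | rfl <;> simp at hk
  rw [mul_resistance_eq hij, mul_resistance_eq hij, hA, hB]
  generalize (∑ T ∈ (trees V).filter (fun T => T.Adj i j), edgeProdErase W s(i, j) T) = B at *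
  generalize (∑ T ∈ (trees V).filter (fun T => ¬ T.Adj i j), edgeProd W T) = A at *
  have h1 : 0 < W s(i, j) * B := mul_pos (hW i j hij) hBpos
  have h2 : 0 < W' s(i, j) * B := mul_pos (hW' i j hij) hBpos
  constructor
  · intro hle
    rw [div_le_div_iff₀ (by positivity) (by positivity)]
    -- After cross-multiplication the quadratic terms cancel and the difference is $(t'-t)BA$.
    have := mul_le_mul_of_nonneg_right hle (mul_nonneg hBpos.le hAnonneg)
    nlinarith
  · intro hcard hlt
    rw [div_lt_div_iff₀ (by positivity) (by positivity)]
    have := mul_lt_mul_of_pos_right hlt (mul_pos hBpos (hApos hcard))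
    nlinarith

end EdgeMarginal

open MeasureTheory Real

/-! ### Gamma and Gaussian integrals for one leaf -/

section Integrals

lemma lintegral_ofReal_rpow_mul_exp {s r : ℝ} (hs : 0 < s) (hr : 0 < r) :
    ∫⁻ t in Set.Ioi (0 : ℝ), ENNReal.ofReal (t ^ (s - 1) * exp (-(r * t))) =
      ENNReal.ofReal ((1 / r) ^ s * Gamma s) := by
  have h := Real.integral_rpow_mul_exp_neg_mul_Ioi hs hr
  have hpos : 0 < (1 / r) ^ s * Gamma s := mul_pos (by positivity) (Gamma_pos_of_pos hs)
  rw [← h, ofReal_integral_eq_lintegral_ofReal]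
  -- A nonintegrable function has Bochner integral zero by convention, but the known value is
  -- positive.
  · by_contra hint
    rw [integral_undef hint] at h
    exact hpos.ne h
  · filter_upwards [ae_restrict_mem measurableSet_Ioi] with t ht
    have : 0 < t := ht
    positivity

lemma lintegral_ofReal_exp_neg_sq {k : ℝ} (hk : 0 < k) (c : ℝ) :
    ∫⁻ b : ℝ, ENNReal.ofReal (exp (-k * (b + c) ^ 2)) = ENNReal.ofReal √(π / k) := by
  rw [lintegral_add_right_eq_self (fun b : ℝ => ENNReal.ofReal (exp (-k * b ^ 2))) c,
    ← integral_gaussian, ofReal_integral_eq_lintegral_ofReal (integrable_exp_neg_mul_sq hk)]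
  exact Filter.Eventually.of_forall fun b => (exp_pos _).le

/-- The integral over the two entries that belong to a leaf and its edge. -/
lemma lintegral_leaf {δ p q r : ℝ} (hδ : 0 < δ) (hr : 0 < r) (hdet : 0 < p * r - q ^ 2) :
    ∫⁻ a in Set.Ioi (0 : ℝ), ∫⁻ b : ℝ, ENNReal.ofReal
      (a ^ ((δ - 2) / 2) * exp (-(a * p + 2 * b * q + b ^ 2 / a * r) / 2)) =
    ENNReal.ofReal (Gamma ((δ + 1) / 2) * (2 * √π * 2 ^ (δ / 2)) * r ^ (δ / 2) /
      (p * r - q ^ 2) ^ ((δ + 1) / 2)) := by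
  set s := (p * r - q ^ 2) / (2 * r) with hs
  have hspos : 0 < s := by positivity
  have h1 : ∀ a ∈ Set.Ioi (0 : ℝ), ∫⁻ b : ℝ, ENNReal.ofReal
      (a ^ ((δ - 2) / 2) * exp (-(a * p + 2 * b * q + b ^ 2 / a * r) / 2)) =
      ENNReal.ofReal √(2 * π / r) *
        ENNReal.ofReal (a ^ ((δ + 1) / 2 - 1) * exp (-(s * a))) := by
    intro a ha
    have ha : 0 < a := ha
    -- Completing the square in `b` leaves the rate `s`, half of $p - q^2/r$.
    have h2 : ∀ b : ℝ, a ^ ((δ - 2) / 2) * exp (-(a * p + 2 * b * q + b ^ 2 / a * r) / 2) =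
        (a ^ ((δ - 2) / 2) * exp (-(s * a))) * exp (-(r / (2 * a)) * (b + a * q / r) ^ 2) := by
      intro b
      rw [mul_assoc (a ^ ((δ - 2) / 2)), ← exp_add]
      congr 2
      rw [hs]
      field_simp
      ring
    have h3 : 0 ≤ a ^ ((δ - 2) / 2) * exp (-(s * a)) := by positivity
    simp_rw [h2, ENNReal.ofReal_mul h3]
    rw [lintegral_const_mul _ (by fun_prop), lintegral_ofReal_exp_neg_sq (by positivity),
      ← ENNReal.ofReal_mul h3, ← ENNReal.ofReal_mul (sqrt_nonneg _)]
    congr 1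
    -- The Gaussian integral contributes $\sqrt a$, which raises the Gamma parameter from $\delta/2$
    -- to $(\delta+1)/2$.
    have h4 : √(π / (r / (2 * a))) = √(2 * π / r) * a ^ (1 / 2 : ℝ) := by
      rw [← sqrt_eq_rpow, ← sqrt_mul (by positivity)]
      congr 1
      field_simp
    rw [h4, show (δ + 1) / 2 - 1 = (δ - 2) / 2 + 1 / 2 by ring, rpow_add ha]
    ring
  rw [setLIntegral_congr_fun measurableSet_Ioi h1, lintegral_const_mul _ (by fun_prop),
    lintegral_ofReal_rpow_mul_exp (by positivity) hspos, ← ENNReal.ofReal_mul (sqrt_nonneg _)]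
  congr 1
  have h5 : (1 / s) ^ ((δ + 1) / 2) =
      2 ^ (δ / 2) * 2 ^ (1 / 2 : ℝ) * (r ^ (δ / 2) * r ^ (1 / 2 : ℝ)) /
        (p * r - q ^ 2) ^ ((δ + 1) / 2) := by
    rw [← rpow_add two_pos, ← rpow_add hr, show δ / 2 + 1 / 2 = (δ + 1) / 2 by ring,
      ← mul_rpow two_pos.le hr.le, ← div_rpow (by positivity) hdet.le, hs, one_div_div]
  rw [h5, ← sqrt_eq_rpow, ← sqrt_eq_rpow, sqrt_div (by positivity), sqrt_mul two_pos.le]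
  have h6 : √(2 : ℝ) * √2 = 2 := mul_self_sqrt two_pos.le
  have h7 : √r ≠ 0 := (sqrt_pos.2 hr).ne'
  have h8 : (p * r - q ^ 2) ^ ((δ + 1) / 2) ≠ 0 := by positivity
  field_simp
  linear_combination h6

end Integrals

/-! ### Splitting one coordinate off a product measure -/

section Pi

variable {ι κ : Type*}

/-- A function on `ι` is a value at the point that corresponds to `none` and a function on `κ`. -/
def consPi (e : Option κ ≃ ι) (x : ℝ × (κ → ℝ)) : ι → ℝ :=
  fun i => (e.symm i).elim x.1 x.2

@[simp] lemma consPi_none (e : Option κ ≃ ι) (x : ℝ × (κ → ℝ)) :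
    consPi e x (e none) = x.1 := by simp [consPi]

@[simp] lemma consPi_some (e : Option κ ≃ ι) (x : ℝ × (κ → ℝ)) (k : κ) :
    consPi e x (e (some k)) = x.2 k := by simp [consPi]

lemma measurePreserving_consPi [Fintype ι] [Fintype κ] (e : Option κ ≃ ι) :
    MeasurePreserving (consPi e) := by
  have hmeas : Measurable (consPi e) := by
    refine measurable_pi_iff.2 fun i => ?_
    obtain ⟨k, rfl⟩ := e.surjective i
    cases k with
    | none => simpa using measurable_fst
    | some k => simpa using (by fun_prop : Measurable fun x : ℝ × (κ → ℝ) => x.2 k)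
  refine ⟨hmeas, (Measure.pi_eq fun s hs => ?_).symm⟩
  have hpre : consPi e ⁻¹' Set.univ.pi s =
      s (e none) ×ˢ Set.univ.pi fun k => s (e (some k)) := by
    ext x
    simp only [Set.mem_preimage, Set.mem_univ_pi, Set.mem_prod]
    constructor
    · intro h
      exact ⟨by simpa using h (e none), fun k => by simpa using h (e (some k))⟩
    · rintro ⟨h1, h2⟩ i
      obtain ⟨k, rfl⟩ := e.surjective i
      cases k with
      | none => simpa using h1
      | some k => simpa using h2 k
  rw [Measure.map_apply hmeas (MeasurableSet.univ_pi hs), hpre, Measure.volume_eq_prod,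
    Measure.prod_prod, volume_pi, Measure.pi_pi, ← e.prod_comp, Fintype.prod_option]

end Pi

/-! ### Schur complement of a leaf -/

section Bordered

variable {n : Type*}

open Classical in
/-- The matrix `N` bordered by a first row and column with entries `a` on the diagonal, `b` at `u`,
and zero elsewhere. -/
def bordered (a b : ℝ) (u : n) (N : Matrix n n ℝ) : Matrix (Unit ⊕ n) (Unit ⊕ n) ℝ :=
  Matrix.fromBlocks (Matrix.of fun _ _ => a) (Matrix.of fun _ y => if y = u then b else 0)
    (Matrix.of fun x _ => if x = u then b else 0) N

lemma pos_of_posDef_bordered {a b : ℝ} {u : n} {N : Matrix n n ℝ}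
    (h : (bordered a b u N).PosDef) : 0 < a :=
  h.diag_pos (i := Sum.inl ())

variable [Fintype n] [DecidableEq n]

/-- The added $b^2/a$ at $(u,u)$ is exactly what the Schur complement of the corner `a` subtracts,
so that complement is `M`. -/
lemma schur_bordered {a : ℝ} (ha : 0 < a) (b : ℝ) (u : n) (M : Matrix n n ℝ) :
    (bordered a b u (M + Matrix.single u u (b ^ 2 / a))).det = a * M.det ∧
    ((bordered a b u (M + Matrix.single u u (b ^ 2 / a))).PosDef ↔ M.PosDef) := by
  classical
  set A : Matrix Unit Unit ℝ := Matrix.of fun _ _ => a with hA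
  set B : Matrix Unit n ℝ := Matrix.of fun _ y => if y = u then b else 0 with hB
  have hAinv : A⁻¹ = Matrix.of fun _ _ => a⁻¹ := by
    refine Matrix.inv_eq_right_inv ?_
    ext
    simp [hA, Matrix.mul_apply, ha.ne']
  have hdetA : A.det = a := by simp [hA]
  let : Invertible A := A.invertibleOfIsUnitDet (by rw [hdetA]; exact ha.ne'.isUnit)
  have hApos : A.PosDef := by
    have : A = Matrix.diagonal fun _ => a := by ext; simp [hA]
    rw [this, Matrix.posDef_diagonal_iff]
    exact fun _ => ha
  have hbord : bordered a b u (M + Matrix.single u u (b ^ 2 / a)) =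
      Matrix.fromBlocks A B B.conjTranspose (M + Matrix.single u u (b ^ 2 / a)) := by
    unfold bordered
    congr 1 <;> ext x y <;> simp [hB]
  have hschur : M + Matrix.single u u (b ^ 2 / a) - B.conjTranspose * A⁻¹ * B = M := by
    rw [hAinv]
    ext x y
    by_cases hx : x = u <;> by_cases hy : y = u <;>
      simp [hB, Matrix.mul_apply, hx, hy, eq_comm (a := u)]
    field_simp
    ring
  have hdet : (bordered a b u (M + Matrix.single u u (b ^ 2 / a))).det = a * M.det := by
    rw [hbord, Matrix.det_fromBlocks₁₁, Matrix.invOf_eq_nonsing_inv, hschur, hdetA]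
  have hsemi : (bordered a b u (M + Matrix.single u u (b ^ 2 / a))).PosSemidef ↔
      M.PosSemidef := by
    rw [hbord, Matrix.PosDef.fromBlocks₁₁ B _ hApos, hschur]
  refine ⟨hdet, fun h => ?_, fun h => ?_⟩
  · refine (hsemi.1 h.posSemidef).posDef_iff_det_ne_zero.2 fun h0 => ?_
    have := h.det_pos
    rw [hdet, h0, mul_zero] at this
    exact lt_irrefl _ this
  · refine (hsemi.2 h.posSemidef).posDef_iff_det_ne_zero.2 ?_
    rw [hdet]
    exact mul_ne_zero ha.ne' h.det_pos.ne'

lemma trace_bordered_mul (a b : ℝ) (u : n) (N : Matrix n n ℝ)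
    (D : Matrix (Unit ⊕ n) (Unit ⊕ n) ℝ) :
    (bordered a b u N * D).trace = a * D (.inl ()) (.inl ()) +
      b * (D (.inl ()) (.inr u) + D (.inr u) (.inl ())) +
      (N * D.submatrix Sum.inr Sum.inr).trace := by
  simp only [Matrix.trace, Matrix.diag, Matrix.mul_apply, bordered, Fintype.sum_sum_type,
    Finset.univ_unique, Finset.sum_singleton, Matrix.fromBlocks_apply₁₁, Matrix.fromBlocks_apply₁₂,
    Matrix.fromBlocks_apply₂₁, Matrix.fromBlocks_apply₂₂, Matrix.of_apply, ite_mul, zero_mul,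
    Finset.sum_ite_eq', Finset.mem_univ, if_true, Matrix.submatrix_apply, Finset.sum_add_distrib]
  simp only [PUnit.default_eq_unit]
  ring

end Bordered

/-! ### Precision matrices in free coordinates -/

section Precision

variable {V : Type*} (T : SimpleGraph V)

lemma precision_self (θ : FreeEntries T) (a : V) : precision T θ a a = θ.1 a := by
  simp [precision]

lemma precision_adj (θ : FreeEntries T) {a b : V} (h : T.Adj a b) :
    precision T θ a b = θ.2 ⟨s(a, b), (SimpleGraph.mem_edgeSet T).2 h⟩ := by
  simp [precision, h, h.ne]

lemma precision_of_not_adj (θ : FreeEntries T) {a b : V} (hne : a ≠ b) (h : ¬ T.Adj a b) :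
    precision T θ a b = 0 := by
  simp [precision, h, hne]

/-- Makes the Schur correction a translation of the free entries, under which Lebesgue measure is
invariant. -/
lemma precision_add_single [DecidableEq V] (θ : FreeEntries T) (u : V) (c : ℝ) :
    precision T (θ + (Pi.single u c, 0)) = precision T θ + Matrix.single u u c := by
  ext a b
  rw [Matrix.add_apply]
  by_cases hab : a = b
  · subst hab
    simp only [precision_self, Prod.fst_add, Pi.add_apply, Pi.single_apply, Matrix.single_apply]
    congr 1
    simp [eq_comm]
  · have h0 : Matrix.single u u c a b = 0 := by
      rw [Matrix.single_apply, if_neg]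
      rintro ⟨rfl, h⟩
      exact hab h
    rw [h0, add_zero]
    by_cases h : T.Adj a b
    · simp [precision_adj _ _ h]
    · rw [precision_of_not_adj _ _ hab h, precision_of_not_adj _ _ hab h]

lemma continuous_precision : Continuous (precision T) := by
  refine continuous_matrix fun a b => ?_
  by_cases hab : a = b
  · subst hab
    simp only [precision_self]
    fun_prop
  · by_cases h : T.Adj a b
    · simp only [precision_adj T _ h]
      fun_prop
    · simp only [precision_of_not_adj T _ hab h]
      fun_prop

lemma measurableSet_cone [Fintype V] [Fintype T.edgeSet] : MeasurableSet (cone T) := by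
  classical
  have h : cone T = {θ | (precision T θ).PosSemidef} ∩ {θ | (precision T θ).det ≠ 0} := by
    ext θ
    exact ⟨fun h => ⟨h.posSemidef, h.det_pos.ne'⟩, fun h => h.1.posDef_iff_det_ne_zero.2 h.2⟩
  rw [h]
  have hc := continuous_precision T
  refine MeasurableSet.inter (IsClosed.measurableSet ?_) (IsOpen.measurableSet ?_)
  · simp only [Matrix.posSemidef_iff_dotProduct_mulVec, Set.ofPred_and, Set.ofPred_forall]
    refine IsClosed.inter (isClosed_eq ?_ hc) (isClosed_iInter fun y =>
      isClosed_le continuous_const ?_)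
    · exact hc.matrix_conjTranspose
    · exact continuous_const.dotProduct (hc.matrix_mulVec continuous_const)
  · exact isOpen_ne_fun hc.matrix_det continuous_const

lemma measurable_wishartKernel_precision [Fintype V] [DecidableEq V] [Fintype T.edgeSet] (δ : ℝ)
    (D : Matrix V V ℝ) : Measurable fun θ => wishartKernel δ D (precision T θ) := by
  have hc := continuous_precision T
  refine Measurable.mul (hc.matrix_det.measurable.pow_const _) (Continuous.measurable ?_)
  exact continuous_exp.comp (((hc.matrix_mul continuous_const).matrix_trace.neg).div_const _)

end Precision

/-- Tonelli, arranged to bring the vertex entry and the edge entry of the leaf outside and to leave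
the free entries of the smaller tree as one variable. -/
lemma lintegral_prod_prod_comm {α β γ ε : Type*} [MeasureSpace α] [MeasureSpace β]
    [MeasureSpace γ] [MeasureSpace ε] [SFinite (volume : Measure α)] [SFinite (volume : Measure β)]
    [SFinite (volume : Measure γ)] [SFinite (volume : Measure ε)]
    {f : (α × β) × γ × ε → ENNReal} (hf : Measurable f) :
    ∫⁻ z, f z = ∫⁻ a, ∫⁻ c, ∫⁻ y : β × ε, f ((a, y.1), (c, y.2)) := by
  rw [Measure.volume_eq_prod, lintegral_prod _ hf.aemeasurable, Measure.volume_eq_prod α β,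
    lintegral_prod _ (hf.lintegral_prod_right').aemeasurable]
  refine lintegral_congr fun a => ?_
  have h1 : ∀ b, ∫⁻ y : γ × ε, f ((a, b), y) = ∫⁻ c, ∫⁻ d, f ((a, b), (c, d)) := fun b => by
    rw [Measure.volume_eq_prod, lintegral_prod _ (by fun_prop)]
  simp_rw [h1]
  rw [lintegral_lintegral_swap]
  · refine lintegral_congr fun c => ?_
    rw [Measure.volume_eq_prod, lintegral_prod _ (by fun_prop)]
  · have : Measurable fun p : (β × γ) × ε => f ((a, p.1.1), (p.1.2, p.2)) := by fun_prop
    exact this.lintegral_prod_right'.aemeasurable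

/-! ### Removing a leaf from a tree -/

section Leaf

variable {V : Type*} {T : SimpleGraph V} {v u : V}

/-- The graph with the vertex `v` removed. -/
abbrev removeVertex (T : SimpleGraph V) (v : V) : SimpleGraph {w // w ≠ v} :=
  T.comap Subtype.val

lemma exists_leaf [Finite V] [Nontrivial V] (hT : T.IsTree) :
    ∃ v u, u ≠ v ∧ (∀ w, T.Adj v w ↔ w = u) ∧ (removeVertex T v).IsTree := by
  classical
  have := Fintype.ofFinite V
  obtain ⟨v, hv⟩ := hT.exists_vert_degree_one_of_nontrivial
  obtain ⟨u, hvu, huniq⟩ := SimpleGraph.degree_eq_one_iff_existsUnique_adj.1 hv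
  exact ⟨v, u, hvu.ne', fun w => ⟨fun h => huniq w h, fun h => h ▸ hvu⟩,
    hT.connected.induce_compl_singleton_of_degree_eq_one hv, hT.isAcyclic.induce {v}ᶜ⟩

/-- The edges of a graph with a leaf `v`: the edge at the leaf, and the edges off the leaf. -/
def leafEdgeMap (hadj : ∀ w, T.Adj v w ↔ w = u) : Option (removeVertex T v).edgeSet → T.edgeSet
  | none => ⟨s(v, u), (hadj u).2 rfl⟩
  | some e => ⟨e.1.map Subtype.val, by
      obtain ⟨e, he⟩ := e
      induction e with
      | h a b => exact he⟩

lemma leafEdgeMap_bijective (hadj : ∀ w, T.Adj v w ↔ w = u) :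
    Function.Bijective (leafEdgeMap hadj) := by
  constructor
  · have hne : ∀ e : (removeVertex T v).edgeSet,
        leafEdgeMap hadj none ≠ leafEdgeMap hadj (some e) := by
      intro e h
      have h1 : v ∈ e.1.map Subtype.val := by
        have h' : s(v, u) = e.1.map Subtype.val := congrArg Subtype.val h
        exact h' ▸ Sym2.mem_mk_left v u
      obtain ⟨w, -, hw⟩ := Sym2.mem_map.1 h1
      exact w.2 hw
    rintro (_ | e) (_ | e') h
    · rfl
    · exact absurd h (hne e')
    · exact absurd h.symm (hne e)
    · exact congrArg some (Subtype.ext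
        (Sym2.map.injective Subtype.val_injective (congrArg Subtype.val h)))
  · rintro ⟨e, he⟩
    induction e with
    | h a b =>
      have he : T.Adj a b := he
      by_cases ha : a = v
      · subst ha
        rw [hadj] at he
        subst he
        exact ⟨none, rfl⟩
      · by_cases hb : b = v
        · subst hb
          have := (hadj a).1 he.symm
          subst this
          exact ⟨none, Subtype.ext Sym2.eq_swap⟩
        · exact ⟨some ⟨s(⟨a, ha⟩, ⟨b, hb⟩), he⟩, rfl⟩

/-- The edges of a graph with a leaf `v`, as an equivalence. -/
def leafEdgeEquiv (hadj : ∀ w, T.Adj v w ↔ w = u) : Option (removeVertex T v).edgeSet ≃ T.edgeSet :=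
  Equiv.ofBijective _ (leafEdgeMap_bijective hadj)

lemma edgeProd_leaf [Fintype V] [DecidableEq V] (hadj : ∀ w, T.Adj v w ↔ w = u)
    (W : Sym2 V → ℝ) :
    edgeProd W T = W s(v, u) * edgeProd (fun e => W (e.map Subtype.val)) (removeVertex T v) := by
  classical
  have h1 : ∀ {V : Type _} [Fintype V] (W : Sym2 V → ℝ) (T : SimpleGraph V),
      edgeProd W T = ∏ e : T.edgeSet, W e := by
    intro V _ W T
    rw [edgeProd]
    exact Finset.prod_subtype _ (fun e => by simp) W
  rw [h1, h1, ← (leafEdgeEquiv hadj).prod_comp, Fintype.prod_option]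
  rfl

/-- The free entries of a graph with a leaf `v`: those of the leaf and its edge, and the others. -/
def leafEntries [DecidableEq V] (hadj : ∀ w, T.Adj v w ↔ w = u)
    (z : (ℝ × ({w // w ≠ v} → ℝ)) × ℝ × ((removeVertex T v).edgeSet → ℝ)) : FreeEntries T :=
  (consPi (Equiv.optionSubtypeNe v) z.1, consPi (leafEdgeEquiv hadj) z.2)

lemma measurePreserving_leafEntries [Fintype V] [DecidableEq V] [Fintype T.edgeSet]
    [Fintype (removeVertex T v).edgeSet] (hadj : ∀ w, T.Adj v w ↔ w = u) :
    MeasurePreserving (leafEntries hadj) :=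
  (measurePreserving_consPi _).prod (measurePreserving_consPi _)

/-- The vertices, as the leaf and the others. -/
def leafSumEquiv [DecidableEq V] (v : V) : Unit ⊕ {w // w ≠ v} ≃ V :=
  ((Equiv.sumComm _ _).trans (Equiv.optionEquivSumPUnit _).symm).trans (Equiv.optionSubtypeNe v)

@[simp] lemma leafSumEquiv_inl [DecidableEq V] (v : V) (x : Unit) :
    leafSumEquiv v (Sum.inl x) = v := by
  simp [leafSumEquiv]

@[simp] lemma leafSumEquiv_inr [DecidableEq V] (v : V) (x : {w // w ≠ v}) :
    leafSumEquiv v (Sum.inr x) = x := by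
  simp [leafSumEquiv]

lemma precision_leafEntries [DecidableEq V] (huv : u ≠ v) (hadj : ∀ w, T.Adj v w ↔ w = u)
    (a b : ℝ) (y : FreeEntries (removeVertex T v)) :
    (precision T (leafEntries hadj ((a, y.1), (b, y.2)))).submatrix (leafSumEquiv v)
      (leafSumEquiv v) = bordered a b ⟨u, huv⟩ (precision (removeVertex T v) y) := by
  have hfst_v : (leafEntries hadj ((a, y.1), (b, y.2))).1 v = a := by
    simpa [leafEntries] using consPi_none (Equiv.optionSubtypeNe v) (a, y.1)
  have hfst : ∀ w : {w // w ≠ v}, (leafEntries hadj ((a, y.1), (b, y.2))).1 w = y.1 w := by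
    intro w
    simpa [leafEntries] using consPi_some (Equiv.optionSubtypeNe v) (a, y.1) w
  have hsnd_v : ∀ h, (leafEntries hadj ((a, y.1), (b, y.2))).2 ⟨s(v, u), h⟩ = b := fun h =>
    consPi_none (leafEdgeEquiv hadj) (b, y.2)
  have hsnd : ∀ (w w' : {w // w ≠ v}) (h : T.Adj w w'),
      (leafEntries hadj ((a, y.1), (b, y.2))).2 ⟨s((w : V), (w' : V)), h⟩ = y.2 ⟨s(w, w'), h⟩ :=
    fun w w' h => consPi_some (leafEdgeEquiv hadj) (b, y.2) ⟨s(w, w'), h⟩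
  ext x x'
  rcases x with x | x <;> rcases x' with x' | x'
  · simp [bordered, precision_self, hfst_v]
  · by_cases h : x' = ⟨u, huv⟩
    · subst h
      simp [bordered, precision_adj T _ ((hadj u).2 rfl), hsnd_v]
    · have h1 : ¬ T.Adj v x' := fun h' => h (Subtype.ext ((hadj _).1 h'))
      simp [bordered, precision_of_not_adj T _ x'.2.symm h1, h]
  · by_cases h : x = ⟨u, huv⟩
    · subst h
      have h2 : (⟨s(u, v), ((hadj u).2 rfl).symm⟩ : T.edgeSet) = ⟨s(v, u), (hadj u).2 rfl⟩ :=
        Subtype.ext Sym2.eq_swap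
      simpa [bordered, precision_adj T _ ((hadj u).2 rfl).symm, h2] using hsnd_v _
    · have h1 : ¬ T.Adj x v := fun h' => h (Subtype.ext ((hadj _).1 h'.symm))
      simp [bordered, precision_of_not_adj T _ x.2 h1, h]
  · simp only [Matrix.submatrix_apply, leafSumEquiv_inr, bordered, Matrix.fromBlocks_apply₂₂]
    by_cases hxx : x = x'
    · subst hxx
      rw [precision_self, precision_self, hfst]
    · by_cases h : T.Adj x x'
      · have h' : (removeVertex T v).Adj x x' := h
        rw [precision_adj T _ h, precision_adj _ _ h']
        exact hsnd x x' h
      · rw [precision_of_not_adj T _ (fun h => hxx (Subtype.ext h)) h,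
          precision_of_not_adj (removeVertex T v) _ hxx h]

lemma trace_submatrix_mul_submatrix {m n : Type*} [Fintype m] [Fintype n] (e : m ≃ n)
    (A B : Matrix n n ℝ) : (A.submatrix e e * B.submatrix e e).trace = (A * B).trace := by
  rw [Matrix.submatrix_mul_equiv]
  exact e.sum_comp fun x => (A * B) x x

/-- The Wishart kernel on the cone of a graph with a leaf splits off the entries of the leaf. -/
lemma wishartKernel_leaf [Fintype V] [DecidableEq V] (huv : u ≠ v)
    (hadj : ∀ w, T.Adj v w ↔ w = u) (δ : ℝ) {D : Matrix V V ℝ} (hD : D.IsSymm)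
    {a : ℝ} (ha : 0 < a) (b : ℝ) (y y' : FreeEntries (removeVertex T v))
    (hy' : y' = y + (Pi.single ⟨u, huv⟩ (b ^ 2 / a), 0)) :
    (leafEntries hadj ((a, y'.1), (b, y'.2)) ∈ cone T ↔ y ∈ cone (removeVertex T v)) ∧
    (y ∈ cone (removeVertex T v) →
      wishartKernel δ D (precision T (leafEntries hadj ((a, y'.1), (b, y'.2)))) =
      a ^ ((δ - 2) / 2) * exp (-(a * D v v + 2 * b * D u v + b ^ 2 / a * D u u) / 2) *
        wishartKernel δ (D.submatrix Subtype.val Subtype.val) (precision (removeVertex T v) y)) := by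
  set u' : {w // w ≠ v} := ⟨u, huv⟩
  set M := precision (removeVertex T v) y with hM
  set N := precision T (leafEntries hadj ((a, y'.1), (b, y'.2))) with hN
  have hsub : N.submatrix (leafSumEquiv v) (leafSumEquiv v) =
      bordered a b u' (M + Matrix.single u' u' (b ^ 2 / a)) := by
    rw [hN, precision_leafEntries huv hadj, hy', precision_add_single]
  obtain ⟨hdet, hpos⟩ := schur_bordered ha b u' M
  rw [← hsub] at hdet hpos
  rw [Matrix.det_submatrix_equiv_self] at hdet
  have hcone : N.PosDef ↔ M.PosDef := by
    refine Iff.trans ⟨fun h => h.submatrix (leafSumEquiv v).injective, fun h => ?_⟩ hpos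
    simpa using h.submatrix (leafSumEquiv v).symm.injective
  refine ⟨hcone, fun hy => ?_⟩
  have hy : M.PosDef := hy
  have htr : (N * D).trace = a * D v v + 2 * b * D u v + b ^ 2 / a * D u u +
      (M * D.submatrix Subtype.val Subtype.val).trace := by
    rw [← trace_submatrix_mul_submatrix (leafSumEquiv v), hsub, trace_bordered_mul]
    have h1 : (D.submatrix (leafSumEquiv v) (leafSumEquiv v)).submatrix Sum.inr Sum.inr =
        D.submatrix (Subtype.val : {w // w ≠ v} → V) Subtype.val := by
      ext; simp
    rw [h1, add_mul, Matrix.trace_add, Matrix.trace_single_mul]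
    simp only [Matrix.submatrix_apply, leafSumEquiv_inl, leafSumEquiv_inr, u',
      smul_eq_mul, ← hD.apply u v]
    ring
  rw [wishartKernel, wishartKernel, hdet, htr, mul_rpow ha.le hy.det_pos.le, neg_add, add_div,
    exp_add]
  ring

end Leaf

/-! ### The Hyper-Wishart normalizing constant -/

section HyperWishart

/-- For fixed `a > 0` and `b`, translating the other entries by the Schur correction makes the
integrand a product and the domain the smaller cone. Finiteness lets the inner integral be pulled
out as a constant. -/
lemma lintegral_cone_leaf {V : Type*} [Fintype V] [DecidableEq V] {T : SimpleGraph V} {v u : V}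
    [Fintype T.edgeSet] [Fintype (removeVertex T v).edgeSet] (huv : u ≠ v)
    (hadj : ∀ w, T.Adj v w ↔ w = u) (δ : ℝ) {D : Matrix V V ℝ} (hD : D.IsSymm)
    (hfin : ∫⁻ y in cone (removeVertex T v), ENNReal.ofReal (wishartKernel δ
      (D.submatrix Subtype.val Subtype.val) (precision (removeVertex T v) y)) ≠ ⊤) :
    ∫⁻ θ in cone T, ENNReal.ofReal (wishartKernel δ D (precision T θ)) =
      (∫⁻ a in Set.Ioi (0 : ℝ), ∫⁻ b : ℝ, ENNReal.ofReal (a ^ ((δ - 2) / 2) *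
        exp (-(a * D v v + 2 * b * D u v + b ^ 2 / a * D u u) / 2))) *
      ∫⁻ y in cone (removeVertex T v), ENNReal.ofReal (wishartKernel δ
        (D.submatrix Subtype.val Subtype.val) (precision (removeVertex T v) y)) := by
  set I := ∫⁻ y in cone (removeVertex T v), ENNReal.ofReal (wishartKernel δ
    (D.submatrix Subtype.val Subtype.val) (precision (removeVertex T v) y)) with hI
  set F : FreeEntries T → ENNReal := (cone T).indicator
    fun θ => ENNReal.ofReal (wishartKernel δ D (precision T θ)) with hF
  have hFmeas : Measurable F :=
    (measurable_wishartKernel_precision T δ D).ennreal_ofReal.indicator (measurableSet_cone T)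
  have hmp := measurePreserving_leafEntries hadj
  have hinv : (volume : Measure (FreeEntries (removeVertex T v))).IsAddRightInvariant :=
    inferInstanceAs ((volume : Measure ({w // w ≠ v} → ℝ)).prod
      (volume : Measure ((removeVertex T v).edgeSet → ℝ))).IsAddRightInvariant
  rw [← lintegral_indicator (measurableSet_cone T), ← hF]
  refine (hmp.lintegral_comp hFmeas).symm.trans
    ((lintegral_prod_prod_comm (hFmeas.comp hmp.measurable)).trans ?_)
  simp only [Function.comp_apply]
  rw [← lintegral_mul_const' _ _ hfin, ← lintegral_indicator measurableSet_Ioi]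
  refine lintegral_congr fun a => ?_
  by_cases ha : 0 < a
  · rw [Set.indicator_of_mem (Set.mem_Ioi.2 ha), ← lintegral_mul_const' _ _ hfin]
    refine lintegral_congr fun b => ?_
    rw [← lintegral_add_right_eq_self _ ((Pi.single ⟨u, huv⟩ (b ^ 2 / a), 0) :
      FreeEntries (removeVertex T v)), hI, ← lintegral_const_mul' _ _ ENNReal.ofReal_ne_top,
      ← lintegral_indicator (measurableSet_cone _)]
    refine lintegral_congr fun y => ?_
    obtain ⟨h1, h2⟩ := wishartKernel_leaf huv hadj δ hD ha b y _ rfl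
    by_cases hy : y ∈ cone (removeVertex T v)
    · rw [Set.indicator_of_mem hy, hF, Set.indicator_of_mem (h1.2 hy), h2 hy,
        ENNReal.ofReal_mul (by positivity)]
    · rw [Set.indicator_of_notMem hy, hF, Set.indicator_of_notMem (fun h => hy (h1.1 h))]
  -- A positive definite matrix has a positive diagonal, so the cone has no points with `a ≤ 0`.
  · rw [Set.indicator_of_notMem (by simpa using ha)]
    have h0 : ∀ (b : ℝ) (y : FreeEntries (removeVertex T v)),
        F (leafEntries hadj ((a, y.1), (b, y.2))) = 0 := by
      intro b y
      refine Set.indicator_of_notMem (fun h => ha ?_) _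
      have h : (precision T _).PosDef := h
      have h' := h.submatrix (leafSumEquiv v).injective
      rw [precision_leafEntries huv hadj] at h'
      exact pos_of_posDef_bordered h'
    simp only [h0, lintegral_zero]

lemma lintegral_cone_of_unique {V : Type*} [inst : Fintype V] [DecidableEq V] [Unique V]
    (T : SimpleGraph V) [Fintype T.edgeSet] {δ : ℝ} (hδ : 0 < δ) {D : Matrix V V ℝ}
    (hD : 0 < D default default) :
    ∫⁻ θ in cone T, ENNReal.ofReal (wishartKernel δ D (precision T θ)) =
      ENNReal.ofReal (Gamma (δ / 2) * 2 ^ (δ / 2) * D default default ^ (-(δ / 2))) := by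
  obtain rfl : inst = Unique.fintype := Subsingleton.elim _ _
  have hE : IsEmpty T.edgeSet := by
    refine ⟨fun ⟨e, he⟩ => ?_⟩
    induction e with
    | h a b => exact SimpleGraph.Adj.ne he (Subsingleton.elim a b)
  have hmeas : Measurable ((cone T).indicator
      fun θ => ENNReal.ofReal (wishartKernel δ D (precision T θ))) :=
    (measurable_wishartKernel_precision T δ D).ennreal_ofReal.indicator (measurableSet_cone T)
  have hprec : ∀ θ : FreeEntries T, precision T θ = Matrix.diagonal fun _ => θ.1 default := by
    intro θ
    ext a b
    rw [Subsingleton.elim a default, Subsingleton.elim b default, precision_self,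
      Matrix.diagonal_apply_eq]
  have hcone : ∀ θ : FreeEntries T, θ ∈ cone T ↔ 0 < θ.1 default := by
    intro θ
    change (precision T θ).PosDef ↔ _
    rw [hprec, Matrix.posDef_diagonal_iff]
    exact ⟨fun h => h default, fun h _ => h⟩
  have hker : ∀ θ : FreeEntries T, wishartKernel δ D (precision T θ) =
      θ.1 default ^ (δ / 2 - 1) * exp (-(D default default / 2 * θ.1 default)) := by
    intro θ
    rw [wishartKernel, hprec, Matrix.det_diagonal, Fintype.prod_unique, Matrix.trace,
      Fintype.sum_unique, Matrix.diag_apply, Matrix.diagonal_mul]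
    congr 2 <;> ring
  rw [← lintegral_indicator (measurableSet_cone T), Measure.volume_eq_prod,
    lintegral_prod _ hmeas.aemeasurable]
  have hdirac : (volume : Measure (T.edgeSet → ℝ)) = Measure.dirac isEmptyElim :=
    Measure.pi_of_empty _
  simp_rw [hdirac]
  have h1 : ∀ x : V → ℝ, ∫⁻ y, (cone T).indicator
      (fun θ => ENNReal.ofReal (wishartKernel δ D (precision T θ))) (x, y)
      ∂(Measure.dirac (isEmptyElim : T.edgeSet → ℝ)) =
      (Set.Ioi (0 : ℝ)).indicator (fun t => ENNReal.ofReal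
        (t ^ (δ / 2 - 1) * exp (-(D default default / 2 * t)))) (x default) := by
    intro x
    rw [lintegral_dirac' _ (by fun_prop)]
    by_cases hx : 0 < x default
    · rw [Set.indicator_of_mem ((hcone _).2 hx), Set.indicator_of_mem (Set.mem_Ioi.2 hx), hker]
    · rw [Set.indicator_of_notMem (mt (hcone _).1 hx), Set.indicator_of_notMem (by simpa using hx)]
  simp_rw [h1]
  have h2 := (volume_preserving_funUnique V ℝ).lintegral_comp_emb
    (MeasurableEquiv.measurableEmbedding _) ((Set.Ioi (0 : ℝ)).indicator fun t => ENNReal.ofReal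
        (t ^ (δ / 2 - 1) * exp (-(D default default / 2 * t))))
  refine h2.trans ?_
  rw [lintegral_indicator measurableSet_Ioi,
    lintegral_ofReal_rpow_mul_exp (by positivity) (by positivity), one_div_div,
    div_rpow two_pos.le hD.le, rpow_neg hD.le]
  congr 1
  ring

/-- The factor of the normalizing constant that does not depend on the tree. -/
def vertexFactor {V : Type*} [Fintype V] (δ : ℝ) (D : Matrix V V ℝ) : ℝ :=
  (2 * √π)⁻¹ * ∏ v, (2 * √π * (Gamma (δ / 2) * 2 ^ (δ / 2) * D v v ^ (-(δ / 2))))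

lemma vertexFactor_pos {V : Type*} [Fintype V] {δ : ℝ} (hδ : 0 < δ) {D : Matrix V V ℝ}
    (hD : D.PosDef) : 0 < vertexFactor δ D := by
  have h1 : 0 < Gamma (δ / 2) := Gamma_pos_of_pos (by positivity)
  have h2 : 0 < √π := sqrt_pos.2 pi_pos
  refine mul_pos (by positivity) (Finset.prod_pos fun v _ => ?_)
  have := hD.diag_pos (i := v)
  positivity

lemma det_submatrix_pair_pos {V : Type*} {D : Matrix V V ℝ} (hD : D.PosDef) {a b : V}
    (hab : a ≠ b) : 0 < (D.submatrix ![a, b] ![a, b]).det := by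
  refine (hD.submatrix ?_).det_pos
  intro x y h
  fin_cases x <;> fin_cases y <;> simp_all

variable {V : Type*}

lemma edgeTerm_pos {δ : ℝ} (hδ : 0 < δ) {D : Matrix V V ℝ} (hD : D.PosDef) {a b : V}
    (hab : a ≠ b) : 0 < edgeTerm δ D a b := by
  have h1 : 0 < Gamma (δ / 2) := Gamma_pos_of_pos (by positivity)
  have h2 : 0 < Gamma ((δ + 1) / 2) := Gamma_pos_of_pos (by positivity)
  have h3 := hD.diag_pos (i := a)
  have h4 := hD.diag_pos (i := b)
  have h5 := det_submatrix_pair_pos hD hab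
  rw [edgeTerm]
  positivity

lemma edgeTerm_symm (δ : ℝ) (D : Matrix V V ℝ) (a b : V) :
    edgeTerm δ D a b = edgeTerm δ D b a := by
  have h : (D.submatrix ![a, b] ![a, b]).det = (D.submatrix ![b, a] ![b, a]).det := by
    rw [Matrix.det_fin_two, Matrix.det_fin_two]
    simp only [Matrix.submatrix_apply, Matrix.cons_val_zero, Matrix.cons_val_one]
    ring
  rw [edgeTerm, edgeTerm, h, mul_comm (D a a)]

/-- Separates the leaf integral into a factor of `v` alone and the edge term; the former collects in
`vertexFactor`. -/
lemma lintegral_leaf_eq_edgeTerm {δ : ℝ} (hδ : 0 < δ) {D : Matrix V V ℝ} (hD : D.PosDef)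
    {v u : V} (huv : u ≠ v) :
    ∫⁻ a in Set.Ioi (0 : ℝ), ∫⁻ b : ℝ, ENNReal.ofReal (a ^ ((δ - 2) / 2) *
      exp (-(a * D v v + 2 * b * D u v + b ^ 2 / a * D u u) / 2)) =
    ENNReal.ofReal (2 * √π * (Gamma (δ / 2) * 2 ^ (δ / 2) * D v v ^ (-(δ / 2))) *
      edgeTerm δ D v u) := by
  have hdet : (D.submatrix ![v, u] ![v, u]).det = D v v * D u u - D u v ^ 2 := by
    have := hD.isHermitian.apply u v
    simp only [star_trivial] at this
    rw [Matrix.det_fin_two]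
    simp only [Matrix.submatrix_apply, Matrix.cons_val_zero, Matrix.cons_val_one, this]
    ring
  have hdpos := det_submatrix_pair_pos hD huv.symm
  have hu := hD.diag_pos (i := u)
  have hv := hD.diag_pos (i := v)
  have h1 : Gamma (δ / 2) ≠ 0 := (Gamma_pos_of_pos (by positivity)).ne'
  rw [lintegral_leaf hδ hu (hdet ▸ hdpos), edgeTerm, hdet, mul_rpow hv.le hu.le, rpow_neg hv.le]
  rw [hdet] at hdpos
  congr 1
  have h2 : D v v ^ (δ / 2) ≠ 0 := by positivity
  field_simp

end HyperWishart

/-- The normalizing constant of the Hyper-Wishart distribution with respect to a tree. -/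
theorem lintegral_cone_wishartKernel {V : Type*} [Fintype V] [DecidableEq V] {T : SimpleGraph V}
    [Fintype T.edgeSet] (hT : T.IsTree) {δ : ℝ} (hδ : 0 < δ) {D : Matrix V V ℝ} (hD : D.PosDef)
    (W : Sym2 V → ℝ) (hW : ∀ a b, a ≠ b → W s(a, b) = edgeTerm δ D a b) :
    ∫⁻ θ in cone T, ENNReal.ofReal (wishartKernel δ D (precision T θ)) =
      ENNReal.ofReal (vertexFactor δ D * edgeProd W T) := by
  classical
  obtain ⟨n, hn⟩ : ∃ n, Fintype.card V = n := ⟨_, rfl⟩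
  induction n generalizing V with
  | zero =>
    have := hT.connected.nonempty
    exact absurd hn Fintype.card_ne_zero
  | succ n ih =>
    have := hT.connected.nonempty
    rcases subsingleton_or_nontrivial V with hsub | hnon
    · let : Unique V := uniqueOfSubsingleton (Classical.arbitrary V)
      rw [lintegral_cone_of_unique T hδ hD.diag_pos]
      have h1 : edgeProd W T = 1 := by
        rw [edgeProd_congr (W' := 1) fun a b hab => absurd (Subsingleton.elim a b) hab.ne]
        exact Finset.prod_const_one
      -- A tree has one edge fewer than vertices: the leading $(2\sqrt\pi)^{-1}$ in `vertexFactor`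
      -- cancels the surplus factor, here that of the only vertex.
      have h2 : √π ≠ 0 := (sqrt_pos.2 pi_pos).ne'
      rw [h1, vertexFactor, Fintype.prod_unique]
      congr 1
      field_simp
    · obtain ⟨v, u, huv, hadj, hT'⟩ := exists_leaf hT
      have hD' : (D.submatrix (Subtype.val : {w // w ≠ v} → V) Subtype.val).PosDef :=
        hD.submatrix Subtype.val_injective
      have hW' : ∀ a b : V, a ≠ b → 0 < W s(a, b) := fun a b hab =>
        (hW a b hab).symm ▸ edgeTerm_pos hδ hD hab
      have hcard : Fintype.card {w // w ≠ v} = n := by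
        rw [Fintype.card_subtype_compl, Fintype.card_subtype_eq, hn, Nat.add_sub_cancel]
      have hI := ih hT' hD' (fun e => W (e.map Subtype.val))
        (fun a b hab => hW a b (fun h => hab (Subtype.ext h))) hcard
      have hsymm : D.IsSymm := by simpa using hD.isHermitian
      rw [lintegral_cone_leaf huv hadj δ hsymm (by rw [hI]; exact ENNReal.ofReal_ne_top), hI,
        lintegral_leaf_eq_edgeTerm hδ hD huv, ← ENNReal.ofReal_mul, edgeProd_leaf hadj,
        hW v u huv.symm]
      · congr 1
        have : vertexFactor δ D = 2 * √π * (Gamma (δ / 2) * 2 ^ (δ / 2) * D v v ^ (-(δ / 2))) *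
            vertexFactor δ (D.submatrix (Subtype.val : {w // w ≠ v} → V) Subtype.val) := by
          rw [vertexFactor, vertexFactor, ← (Equiv.optionSubtypeNe v).prod_comp,
            Fintype.prod_option]
          simp only [Equiv.optionSubtypeNe_none, Equiv.optionSubtypeNe_some,
            Matrix.submatrix_apply]
          ring
        rw [this]
        ring
      · have h1 : 0 < Gamma (δ / 2) := Gamma_pos_of_pos (by positivity)
        have h2 := edgeTerm_pos hδ hD huv.symm
        have h3 := hD.diag_pos (i := v)
        positivity

/-! ### Weights on unordered pairs -/

section WeightSym2

variable {V : Type*}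

/-- The edge terms as a function on unordered pairs. -/
def edgeTermSym2 (δ : ℝ) (D : Matrix V V ℝ) : Sym2 V → ℝ :=
  Sym2.lift ⟨edgeTerm δ D, edgeTerm_symm δ D⟩

/-- The weights as a function on unordered pairs. -/
def weightSym2 (δ : ℝ) (D : Matrix V V ℝ) {n : ℕ} (x : Matrix (Fin n) V ℝ) : Sym2 V → ℝ :=
  fun e => edgeTermSym2 (δ + n) (D + x.transpose * x) e / edgeTermSym2 δ D e

lemma pairWeight_weightSym2 (δ : ℝ) (D : Matrix V V ℝ) {n : ℕ} (x : Matrix (Fin n) V ℝ) :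
    pairWeight (weightSym2 δ D x) = weight δ D x := rfl

end WeightSym2

/-! ### Conjugacy and the posterior on trees -/

section Posterior

variable {V : Type*} [Fintype V]

lemma hyperWishartConst_eq [DecidableEq V] {T : SimpleGraph V} (hT : T.IsTree) {δ : ℝ} (hδ : 0 < δ)
    {D : Matrix V V ℝ} (hD : D.PosDef) (W : Sym2 V → ℝ)
    (hW : ∀ a b, a ≠ b → W s(a, b) = edgeTerm δ D a b) :
    hyperWishartConst δ D T = vertexFactor δ D * edgeProd W T := by
  classical
  have hpos : 0 < vertexFactor δ D * edgeProd W T :=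
    mul_pos (vertexFactor_pos hδ hD)
      (edgeProd_pos (fun a b hab => (hW a b hab).symm ▸ edgeTerm_pos hδ hD hab) T)
  rw [hyperWishartConst, integral_eq_lintegral_of_nonneg_ae,
    lintegral_cone_wishartKernel hT hδ hD W hW, ENNReal.toReal_ofReal hpos.le]
  · filter_upwards [ae_restrict_mem (measurableSet_cone T)] with θ hθ
    have hdet : 0 < (precision T θ).det := Matrix.PosDef.det_pos hθ
    rw [Pi.zero_apply, wishartKernel]
    positivity
  · exact (measurable_wishartKernel_precision T δ D).aestronglyMeasurable

/-- Conjugacy: each observation contributes $|\Delta|^{1/2}$, raising `δ` by one, and the quadratic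
forms add up to $\mathrm{tr}(\Delta x^\top x)$. -/
lemma likelihood_mul_wishartKernel [DecidableEq V] {n : ℕ} (x : Matrix (Fin n) V ℝ) (δ : ℝ) (D : Matrix V V ℝ)
    {Δ : Matrix V V ℝ} (hΔ : Δ.PosDef) :
    likelihood x Δ * wishartKernel δ D Δ = ((2 * π) ^ (-(Fintype.card V : ℝ) / 2)) ^ n *
      wishartKernel (δ + n) (D + x.transpose * x) Δ := by
  have hdet := hΔ.det_pos
  have h1 : ∀ l, gaussianDensity Δ⁻¹ (x l) = (2 * π) ^ (-(Fintype.card V : ℝ) / 2) *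
      Δ.det ^ (1 / 2 : ℝ) * exp (-(x l ⬝ᵥ Δ.mulVec (x l)) / 2) := by
    intro l
    rw [gaussianDensity, Matrix.nonsing_inv_nonsing_inv _ hdet.ne'.isUnit, Matrix.det_nonsing_inv,
      Ring.inverse_eq_inv', inv_rpow hdet.le, rpow_neg hdet.le, inv_inv]
  have h2 : ∑ l, x l ⬝ᵥ Δ.mulVec (x l) = (Δ * (x.transpose * x)).trace := by
    simp only [Matrix.trace, Matrix.diag_apply, Matrix.mul_apply, dotProduct, Matrix.mulVec,
      Finset.mul_sum, Matrix.transpose_apply]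
    rw [Finset.sum_comm]
    refine Finset.sum_congr rfl fun a _ => ?_
    rw [Finset.sum_comm]
    exact Finset.sum_congr rfl fun b _ => Finset.sum_congr rfl fun l _ => by ring
  rw [likelihood, Finset.prod_congr rfl fun l _ => h1 l, Finset.prod_mul_distrib,
    Finset.prod_const, Finset.card_univ, Fintype.card_fin, ← exp_sum, ← Finset.sum_div,
    Finset.sum_neg_distrib, h2, wishartKernel, wishartKernel, Matrix.mul_add, Matrix.trace_add,
    neg_add, add_div, exp_add, mul_pow,
    show (δ + n - 2) / 2 = (δ - 2) / 2 + 1 / 2 * n by ring, rpow_add hdet, rpow_mul hdet.le,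
    rpow_natCast]
  ring

lemma posDef_add_transpose_mul {n : ℕ} {D : Matrix V V ℝ} (hD : D.PosDef)
    (x : Matrix (Fin n) V ℝ) : (D + x.transpose * x).PosDef :=
  hD.add_posSemidef (by simpa using Matrix.posSemidef_conjTranspose_mul_self x)

lemma weight_pos [DecidableEq V] {δ : ℝ} (hδ : 0 < δ) {D : Matrix V V ℝ} (hD : D.PosDef) {n : ℕ}
    (x : Matrix (Fin n) V ℝ) {a b : V} (hab : a ≠ b) : 0 < weight δ D x a b :=
  div_pos (edgeTerm_pos (by positivity) (posDef_add_transpose_mul hD x) hab)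
    (edgeTerm_pos hδ hD hab)

/-- The marginal likelihood of a tree is proportional to the product of the weights of its edges. -/
lemma exists_treeLikelihood_eq [DecidableEq V] {δ : ℝ} (hδ : 0 < δ) {D : Matrix V V ℝ} (hD : D.PosDef) {n : ℕ}
    (x : Matrix (Fin n) V ℝ) : ∃ K : ℝ, 0 < K ∧ ∀ T : SimpleGraph V, T.IsTree →
      treeLikelihood δ D x T = K * edgeProd (weightSym2 δ D x) T := by
  classical
  have hδ' : 0 < δ + n := by positivity
  have hD' := posDef_add_transpose_mul hD x
  refine ⟨((2 * π) ^ (-(Fintype.card V : ℝ) / 2)) ^ n *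
    (vertexFactor (δ + n) (D + x.transpose * x) / vertexFactor δ D), ?_, fun T hT => ?_⟩
  · have := vertexFactor_pos hδ hD
    have := vertexFactor_pos hδ' hD'
    positivity
  · have h1 : treeLikelihood δ D x T = ((2 * π) ^ (-(Fintype.card V : ℝ) / 2)) ^ n *
        hyperWishartConst (δ + n) (D + x.transpose * x) T / hyperWishartConst δ D T := by
      rw [treeLikelihood, hyperWishartConst.eq_def (δ + n), ← integral_const_mul,
        ← integral_div]
      refine setIntegral_congr_fun (measurableSet_cone T) fun θ hθ => ?_
      rw [hyperWishartDensity, ← mul_div_assoc, likelihood_mul_wishartKernel x δ D hθ]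
    have h2 : edgeProd (weightSym2 δ D x) T =
        edgeProd (edgeTermSym2 (δ + n) (D + x.transpose * x)) T / edgeProd (edgeTermSym2 δ D) T :=
      Finset.prod_div_distrib _ _
    rw [h1, h2, hyperWishartConst_eq hT hδ hD (edgeTermSym2 δ D) (fun _ _ _ => rfl),
      hyperWishartConst_eq hT hδ' hD' (edgeTermSym2 _ _) (fun _ _ _ => rfl), mul_div_assoc,
      mul_div_mul_comm, mul_assoc]

/-- The uniform prior and the constant `K` do not depend on the tree and cancel, leaving the ratio
in `mul_resistance_eq_div`. -/
lemma edgeProb_eq [DecidableEq V] {δ : ℝ} (hδ : 0 < δ) {D : Matrix V V ℝ} (hD : D.PosDef) {n : ℕ}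
    (x : Matrix (Fin n) V ℝ) {i j : V} (hij : i ≠ j) :
    edgeProb δ D x i j = weight δ D x i j * resistance (weight δ D x) i j := by
  classical
  obtain ⟨K, hK, hlik⟩ := exists_treeLikelihood_eq hδ hD x
  have h := mul_resistance_eq_div hij (weightSym2 δ D x)
  rw [pairWeight_weightSym2] at h
  refine Eq.trans ?_ h.symm
  have hcard : (0 : ℝ) < ((trees V).card : ℝ)⁻¹ := by
    obtain ⟨T, hT, -⟩ := exists_star i
    have : 0 < (trees V).card := Finset.card_pos.2 ⟨T, mem_trees.2 hT⟩
    positivity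
  have h1 : ∀ T ∈ trees V, treePrior V T * treeLikelihood δ D x T =
      ((trees V).card : ℝ)⁻¹ * K * edgeProd (weightSym2 δ D x) T := fun T hT => by
    rw [treePrior, hlik T (mem_trees.1 hT), mul_assoc]
  have h2 : treeActivation δ D x =
      ((trees V).card : ℝ)⁻¹ * K * ∑ T ∈ trees V, edgeProd (weightSym2 δ D x) T := by
    rw [treeActivation, Finset.sum_congr rfl h1, Finset.mul_sum]
  simp only [edgeProb, treePosterior]
  rw [← Finset.sum_div, h2,
    Finset.sum_congr rfl fun T hT => h1 T (Finset.mem_of_mem_filter T hT), ← Finset.mul_sum,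
    mul_div_mul_left _ _ (mul_pos hcard hK).ne']

end Posterior

end

end TreeActivation

theorem proposition2 {V : Type*} [Fintype V] [DecidableEq V] (i j : V) (hij : i ≠ j) :
    -- (i) the posterior is well defined and the edge probability is `w_ij * r(i, j)`
    (∀ (δ : ℝ) (D : Matrix V V ℝ) (n : ℕ) (x : Matrix (Fin n) V ℝ), 0 < δ → D.PosDef →
      (∀ T : SimpleGraph V, T.IsTree → 0 < TreeActivation.treeLikelihood δ D x T) ∧
      TreeActivation.edgeProb δ D x i j =
        TreeActivation.weight δ D x i j *
          TreeActivation.resistance (TreeActivation.weight δ D x) i j) ∧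
    -- (ii) the expression in (i) increases in the weight of `{i, j}`, the others being fixed
    (∀ w : V → V → ℝ, (∀ a b, w a b = w b a) → (∀ a b, a ≠ b → 0 < w a b) →
      MonotoneOn
        (fun t : ℝ => t * TreeActivation.resistance (TreeActivation.setWeight w i j t) i j)
        (Set.Ioi 0) ∧
      (3 ≤ Fintype.card V → StrictMonoOn
        (fun t : ℝ => t * TreeActivation.resistance (TreeActivation.setWeight w i j t) i j)
        (Set.Ioi 0))) ∧
    -- (ii) in terms of the model: if only the weight of `{i, j}` differs, the edge probability
    -- is larger where that weight is larger
    (∀ (δ δ' : ℝ) (D D' : Matrix V V ℝ) (n n' : ℕ) (x : Matrix (Fin n) V ℝ)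
        (x' : Matrix (Fin n') V ℝ), 0 < δ → 0 < δ' → D.PosDef → D'.PosDef →
      (∀ a b, a ≠ b → s(a, b) ≠ s(i, j) →
        TreeActivation.weight δ D x a b = TreeActivation.weight δ' D' x' a b) →
      (TreeActivation.weight δ D x i j ≤ TreeActivation.weight δ' D' x' i j →
        TreeActivation.edgeProb δ D x i j ≤ TreeActivation.edgeProb δ' D' x' i j) ∧
      (3 ≤ Fintype.card V →
        TreeActivation.weight δ D x i j < TreeActivation.weight δ' D' x' i j →
        TreeActivation.edgeProb δ D x i j < TreeActivation.edgeProb δ' D' x' i j)) := by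
  refine ⟨fun δ D n x hδ hD => ⟨fun T hT => ?_, TreeActivation.edgeProb_eq hδ hD x hij⟩,
    fun w hsymm hpos => ?_, fun δ δ' D D' n n' x x' hδ hδ' hD hD' h => ?_⟩
  · obtain ⟨K, hK, hlik⟩ := TreeActivation.exists_treeLikelihood_eq hδ hD x
    rw [hlik T hT]
    exact mul_pos hK (TreeActivation.edgeProd_pos
      (fun a b hab => TreeActivation.weight_pos hδ hD x hab) T)
  -- Symmetry lets `w` descend to unordered pairs; `pairWeight` of these functions is `setWeight w i
  -- j` by definition.
  · have key : ∀ s ∈ Set.Ioi (0 : ℝ), ∀ t ∈ Set.Ioi (0 : ℝ), _ := fun s hs t ht =>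
      TreeActivation.mul_resistance_mono hij
        (W := fun e => if e = s(i, j) then s else Sym2.lift ⟨w, hsymm⟩ e)
        (W' := fun e => if e = s(i, j) then t else Sym2.lift ⟨w, hsymm⟩ e)
        (fun a b hab => by
          split_ifs
          exacts [hs, hpos a b hab])
        (fun a b hab => by
          split_ifs
          exacts [ht, hpos a b hab])
        (fun a b _ hne => by rw [if_neg hne, if_neg hne])
    simp only [if_true] at key
    exact ⟨fun s hs t ht hst => (key s hs t ht).1 hst,
      fun hcard s hs t ht hst => (key s hs t ht).2 hcard hst⟩
  · rw [TreeActivation.edgeProb_eq hδ hD x hij, TreeActivation.edgeProb_eq hδ' hD' x' hij]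
    exact TreeActivation.mul_resistance_mono hij (W := TreeActivation.weightSym2 δ D x)
      (W' := TreeActivation.weightSym2 δ' D' x')
      (fun a b hab => TreeActivation.weight_pos hδ hD x hab)
      (fun a b hab => TreeActivation.weight_pos hδ' hD' x' hab) h
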